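/- Let $k$ be a finite field with $q$ elements and $A=k[T]$. For a field $L\supseteq k$ with algebraic (or separable) closure $\bar L$, a normalized Drinfeld module over $L$ is given by $\phi_T=1+g\tau-\tau^2$ with $g\in L$, where $\tau(y)=y^q$ (so $\gamma(T)=1$); it makes $\bar L$ an $A$-module. For $n\ge 1$ consider triples $(\phi,x_1,G_n)$ where $\phi$ is normalized over $L$, $x_1\in L$ is a nonzero $T$-torsion point of $\phi$, and $G_n\subset\bar L$ is an $A$-submodule isomorphic to $A/T^nA$, containing $x_1$ and permuted by the automorphisms of $\bar L$ over $L$. For $x\neq0$ put $P_x(Y)=x^{q-1}Y-Y^q$. (1) For every field $L\supseteq k$ and every $n\ge1$, these triples correspond bijectively to the tuples $(x_1,\dots,x_n)\in L^n$ with $x_1\ne0$ and $$x_j=\frac{z_j}{x_{j-1}},\qquad z_j^q+z_j=x_{j-1}^{q+1}\qquad(1<j\le n).\tag{$*$}$$ The tuple $(x_1,\dots,x_n)$ corresponds to the module with $g=x_1^{-q}(x_1^{q^2}-x_1)$, the point $x_1$, and the group $G_n$ of zeros in $\bar L$ of $P_{x_n}\circ\cdots\circ P_{x_1}$. The equation $(P_{x_{n-1}}\circ\cdots\circ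 P_{x_1})(y)=x_n$ has exactly $q^{n-1}$ solutions $y\in\bar L$, and each of them generates $G_n$ as an $A$-module. For $n\ge2$ the map $(\phi,x_1,G_n)\mapsto(\phi,x_1,\phi_T(G_n))$ corresponds to omitting $x_n$. (2) Let $E\supseteq k$ be any field, and let $\phi_T=1+g\tau-\tau^2$ be the generic normalized module over the rational function field $E(g)$, with $\Omega$ a separable closure of $E(g)$. For every $n\ge1$ the pairs $(x_1,G_n)$ of a nonzero $T$-torsion point and a submodule $G_n\cong A/T^nA$ of $\Omega$ containing it form a single nonempty orbit under $\mathrm{Gal}(\Omega/E(g))$. Hence the curve $\dot X'_0(T^n)$ over $E$ that parametrizes them is irreducible, and its function field $F_n$ is the fixed field of the stabilizer of one such pair. One has $F_n=E(x_1,\dots,x_n)$, where the $x_j\in\Omega$ satisfy $(*)$, $g=x_1^{-q}(x_1^{q^2}-x_1)$, and $G_n$ is the zero set of $P_{x_n}\circ\cdots\circ P_{x_1}$. These relations are defining: $x_1$ is transcendental over $E$ and, for $1<j\le n$, the minimal polynomial of $z_j=x_{j-1}x_j$ over $E(x_1,\dots,x_{j-1})$ is $Y^q+Y-x_{j-1}^{q+1}$.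 (3) There are sequences $(G_n)_{n\ge1}$ of such groups, all containing the same $x_1$, with $\phi_T(G_{n+1})=G_n$. For every such sequence the tower $F_1\subset F_2\subset\cdots$ of function fields of the curves $\dot X'_0(T^n)$ is the Garcia–Stichtenoth tower over $E$: $F_1=E(x_1)$ and $F_{n+1}=F_n(z_{n+1})$ with $z_{n+1}$ a root of the irreducible polynomial $Y^q+Y-x_n^{q+1}$ over $F_n$ and $x_{n+1}=z_{n+1}/x_n$. (4) In particular $\dot X'_0(T^2)$ is the Hermitian curve $z^q+z=x^{q+1}$, with $x=x_1$ and $z=x_1x_2$: the function field of this plane curve over $E$ is isomorphic to $F_2$ in this way. If $E$ is the quadratic extension of $k$, it is isomorphic over $E$ to the Fermat curve $u^{q+1}+v^{q+1}=1$ (the function fields are isomorphic over $E$). -/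

import Mathlib

open Polynomial IntermediateField
open scoped Pointwise

universe u v w

/-- The `q`-power Frobenius `τ : y ↦ y ^ q`, `q = #k`, as a `k`-linear endomorphism of a commutative
`k`-algebra `Ω`. -/
noncomputable def frobEnd (k : Type u) (Ω : Type w) [Field k] [Fintype k] [Field Ω] [Algebra k Ω] :
    Module.End k Ω :=
  (FiniteField.frobeniusAlgHom k Ω).toLinearMap

/-- A rank-two Drinfeld `k[T]`-module over `L`, given by the coefficients of
`φ_T = l₀ + g τ + Δ τ²` with `Δ ≠ 0`; here `γ(T) = l₀`. -/
@[ext]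
structure DrinfeldModule (L : Type v) [Field L] where
  l₀ : L
  g : L
  Δ : L
  Δ_ne_zero : Δ ≠ 0

namespace DrinfeldModule

/-- `φ` is normalized with `γ(T) = 1`, i.e. `φ_T = 1 + g τ - τ²`. -/
def IsNormalized {L : Type v} [Field L] (φ : DrinfeldModule L) : Prop :=
  φ.l₀ = 1 ∧ φ.Δ = -1

/-- The normalized module `φ_T = 1 + g τ - τ²`. -/
def normalized {L : Type v} [Field L] (g : L) : DrinfeldModule L :=
  ⟨1, g, -1, neg_ne_zero.mpr one_ne_zero⟩

section Action

variable (k : Type u) {L : Type v} (Ω : Type w) [Field k] [Fintype k] [Field L] [Field Ω]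
  [Algebra k L] [Algebra k Ω] [Algebra L Ω] [IsScalarTower k L Ω]

/-- `φ_T` as the operator `y ↦ l₀ y + g y ^ q + Δ y ^ (q ^ 2)` on an extension `Ω` of `L`. -/
noncomputable def opT (φ : DrinfeldModule L) : Module.End k Ω :=
  φ.l₀ • (1 : Module.End k Ω) + φ.g • frobEnd k Ω + φ.Δ • frobEnd k Ω ^ 2

/-- The action `a ↦ φ_a` of `A = k[T]` on `Ω`. -/
noncomputable def action (φ : DrinfeldModule L) : k[X] →ₐ[k] Module.End k Ω :=
  aeval (φ.opT k Ω)

/-- `Ω` as an `A`-module through `φ`. -/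
abbrev Points (φ : DrinfeldModule L) : Type w := Module.AEval' (φ.opT k Ω)

variable {Ω}

/-- `G` is an `A`-submodule of `Ω` (for the action through `φ`) isomorphic to `A / T ^ n A`. -/
def IsCyclicTorsion (φ : DrinfeldModule L) (n : ℕ) (G : Set Ω) : Prop :=
  ∃ M : Submodule k[X] (φ.Points k Ω),
    Nonempty (M ≃ₗ[k[X]] (k[X] ⧸ Ideal.span {(X : k[X]) ^ n})) ∧
    ∀ y : Ω, y ∈ G ↔ Module.AEval'.of (φ.opT k Ω) y ∈ M

/-- A (geometric) level structure on `φ`: a nonzero `T`-torsion point `x₁` together with a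
cyclic `T ^ n`-torsion subgroup `G` containing it. -/
structure IsLevelStructure (φ : DrinfeldModule L) (n : ℕ) (x₁ : Ω) (G : Set Ω) : Prop where
  ne_zero : x₁ ≠ 0
  torsion : φ.opT k Ω x₁ = 0
  cyclic : φ.IsCyclicTorsion k n G
  mem : x₁ ∈ G

/-- A point over `L` of the moduli problem: a normalized `φ` over `L`, a point `x₁` with
coordinates in `L`, and a cyclic `T ^ n`-torsion subgroup `G ∋ x₁` that is permuted by the
automorphisms of `Ω` over `L`. (`Ω` is an algebraic or separable closure of `L`.) -/
structure IsModuliPoint (φ : DrinfeldModule L) (n : ℕ) (x₁ : L) (G : Set Ω) : Prop where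
  normalized : φ.IsNormalized
  level : φ.IsLevelStructure k n (algebraMap L Ω x₁) G
  stable : ∀ (σ : Ω ≃ₐ[L] Ω), ∀ y ∈ G, σ y ∈ G

end Action

end DrinfeldModule

/-- The linearized polynomial `P_x(Y) = x ^ (q - 1) Y - Y ^ q`, as an operator. -/
noncomputable def opP (k : Type u) {Ω : Type w} [Field k] [Fintype k] [Field Ω] [Algebra k Ω]
    (x : Ω) : Module.End k Ω :=
  x ^ (Fintype.card k - 1) • (1 : Module.End k Ω) - frobEnd k Ω

/-- The composition `P_{x_n} ∘ ⋯ ∘ P_{x_1}`, where `x_j` is `x (j - 1)`. -/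
noncomputable def opPComp (k : Type u) {Ω : Type w} [Field k] [Fintype k] [Field Ω]
    [Algebra k Ω] : (n : ℕ) → (Fin n → Ω) → Module.End k Ω
  | 0, _ => 1
  | n + 1, x => opP k (x (Fin.last n)) * opPComp k n (Fin.init x)

/-- The zeros in `Ω` of `P_{x_n} ∘ ⋯ ∘ P_{x_1}`. -/
def zerosP (k : Type u) {Ω : Type w} [Field k] [Fintype k] [Field Ω] [Algebra k Ω]
    {n : ℕ} (x : Fin n → Ω) : Set Ω :=
  {y | opPComp k n x y = 0}

/-- The tuples `(x_1, …, x_{n+1})`, `x_1 ≠ 0`, with `x_j = z_j / x_{j-1}` and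
`z_j ^ q + z_j = x_{j-1} ^ (q + 1)` for `1 < j ≤ n + 1`. -/
def gsCurve (q : ℕ) (L : Type v) [Field L] (n : ℕ) : Set (Fin (n + 1) → L) :=
  {x | x 0 ≠ 0 ∧ ∀ j : Fin n, ∃ z : L,
    z ^ q + z = x j.castSucc ^ (q + 1) ∧ x j.succ = z / x j.castSucc}

/-- The Drinfeld module `φ_T = 1 + x ^ (-q) (x ^ (q ^ 2) - x) τ - τ²`. -/
noncomputable def tModule (q : ℕ) {L : Type v} [Field L] (x : L) : DrinfeldModule L :=
  DrinfeldModule.normalized ((x ^ q)⁻¹ * (x ^ (q ^ 2) - x))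

/-- For a Galois extension `Ω / K`: the field fixed by all automorphisms that fix `x₁` and map `G`
onto itself. If `K` is the function field of a base curve, `Ω` its separable closure and
`(x₁, G)` a level structure on the generic object over `K`, this is the function field of
the covering curve that parametrizes such level structures (the component of `(x₁, G)`). -/
noncomputable def levelField (K : Type v) {Ω : Type w} [Field K] [Field Ω] [Algebra K Ω]
    (x₁ : Ω) (G : Set Ω) : IntermediateField K Ω :=
  fixedField (MulAction.stabilizer (Ω ≃ₐ[K] Ω) x₁ ⊓ MulAction.stabilizer (Ω ≃ₐ[K] Ω) G)

/-- The Garcia–Stichtenoth tower over `E`: `F_1 = E(x_1)` is a rational function field, and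
`F_{n+1} = F_n(z_{n+1})` where `z_{n+1}` has the irreducible equation
`Y ^ q + Y = x_n ^ (q + 1)` over `F_n`, and `x_{n+1} = z_{n+1} / x_n`.
The indices of `F` and `x` are shifted by one, that of `z` by two. -/
structure IsGarciaStichtenothTower (q : ℕ) (E : Type v) {Ω : Type w} [Field E] [Field Ω]
    [Algebra E Ω] (F : ℕ → IntermediateField E Ω) (x z : ℕ → Ω) : Prop where
  transcendental : Transcendental E (x 0)
  base : F 0 = E⟮x 0⟯
  step : ∀ n, F (n + 1) = ((F n)⟮z n⟯).restrictScalars E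
  equation : ∀ n, (minpoly (F n) (z n)).map (algebraMap (F n) Ω) =
    X ^ q + X - C (x n ^ (q + 1))
  next : ∀ n, x (n + 1) = z n / x n

/-- The function field (total ring of fractions of the coordinate ring) of the affine plane curve
`f = 0`. -/
abbrev PlaneCurveField {E : Type v} [Field E] (f : MvPolynomial (Fin 2) E) : Type v :=
  FractionRing (MvPolynomial (Fin 2) E ⧸ Ideal.span {f})

/-- The image of a polynomial in `PlaneCurveField f`; coordinates are the images of the variables. -/
noncomputable def PlaneCurveField.ofPoly {E : Type v} [Field E] (f p : MvPolynomial (Fin 2) E) :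
    PlaneCurveField f :=
  algebraMap (MvPolynomial (Fin 2) E ⧸ Ideal.span {f}) _ (Ideal.Quotient.mk _ p)

/-- `z ^ q + z - x ^ (q + 1)` in the variables `x = X 0`, `z = X 1`. -/
noncomputable def hermitianPoly (q : ℕ) (E : Type v) [Field E] : MvPolynomial (Fin 2) E :=
  MvPolynomial.X 1 ^ q + MvPolynomial.X 1 - MvPolynomial.X 0 ^ (q + 1)

/-- The Fermat polynomial `u ^ (q + 1) + v ^ (q + 1) - 1`. -/
noncomputable def fermatPoly (q : ℕ) (E : Type v) [Field E] : MvPolynomial (Fin 2) E :=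
  MvPolynomial.X 0 ^ (q + 1) + MvPolynomial.X 1 ^ (q + 1) - 1

/-! If `x ≠ 0` is killed by `φ_T = 1 + g τ - τ²`, then `φ_T = U_x P_x` with `U_x = x ^ (1 - q) + τ`.
Swapping the factors gives `P_x U_x`, again of the form `1 + g' τ - τ²`: this is the quotient of `φ`
by the line `k x`, and `P_x` is the isogeny onto it. Multiplied by `x ^ q`, the equation `U_x y = x`
becomes (*) for `z = x y`. It makes `y` a `T`-torsion point of the quotient outside the kernel of
`U_x`, so the construction repeats with `y`, and the composite kernel stays cyclic
(`opPSeq_mul_opN`, `IsGSSeq.range_aeval_eq`).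

Conversely, let `y` generate `G`, scaled so that a power of `φ_T` takes it to `x₁`. The successive
`x_j` are the images under the partial compositions of the multiples of `y` by powers of `φ_T`. They
depend only on `(x₁, G)` (`IsGSSeq.eq_of_seqZeros_eq`): each is determined up to a scalar in `k`,
and `U` fixes the scalar. Hence Galois-stable data have Galois-fixed coordinates. These lie in `L`
because their equations are separable.

For the generic module, take a valuation trivial on `E` at which `x₁` has a pole. The relations give
`v(x_j) = v(x_{j+1}) ^ q` and `v(z) = v(x_{j+1}) ^ (q + 1)`, so each step is totally ramified and
its equation is irreducible (`IsGSSeq.tower_step`). Conjugations therefore extend coordinate by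
coordinate, starting from the conjugacy of all nonzero torsion points. Galois theory identifies the
field of `(x₁, G)` with `E(x₁, …, x_n)`.

At level `T²`, division by an equation that is monic in one variable, of the right degree,
identifies the ideal of the generic point. A projective change of coordinates gives the Fermat form.
-/

theorem pow_card_pred_mul (k : Type u) [Field k] [Fintype k] {Ω : Type w} [Field Ω] (x : Ω) :
    x ^ (Fintype.card k - 1) * x = x ^ Fintype.card k :=
  pow_sub_one_mul Fintype.card_ne_zero x

/-! ### Factorization of `φ_T` into `q`-polynomials of degree `q` -/

section Operators

variable {k : Type u} [Field k] [Fintype k] {Ω : Type w} [Field Ω] [Algebra k Ω]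

local notation "q" => Fintype.card k

@[simp]
theorem frobEnd_apply (y : Ω) : frobEnd k Ω y = y ^ q := rfl

theorem pow_card_add (a b : Ω) : (a + b) ^ q = a ^ q + b ^ q :=
  map_add (frobEnd k Ω) a b

theorem pow_card_sub (a b : Ω) : (a - b) ^ q = a ^ q - b ^ q :=
  map_sub (frobEnd k Ω) a b

@[simp]
theorem opP_apply (x y : Ω) : opP k x y = x ^ (q - 1) * y - y ^ q := by
  simp [opP]

/-- The operator `U_x = x ^ (1 - q) + τ`, for which `U_x P_x = φ_T` if `φ_T x = 0`. -/
noncomputable def opU (k : Type u) [Field k] [Fintype k] {Ω : Type w} [Field Ω] [Algebra k Ω]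
    (x : Ω) : Module.End k Ω :=
  (x ^ (Fintype.card k - 1))⁻¹ • (1 : Module.End k Ω) + frobEnd k Ω

@[simp]
theorem opU_apply (x y : Ω) : opU k x y = (x ^ (q - 1))⁻¹ * y + y ^ q := by
  simp [opU]

/-- The operator `1 + g τ - τ²`. -/
noncomputable def opN (k : Type u) [Field k] [Fintype k] {Ω : Type w} [Field Ω] [Algebra k Ω]
    (g : Ω) : Module.End k Ω :=
  1 + g • frobEnd k Ω - frobEnd k Ω ^ 2

@[simp]
theorem opN_apply (g y : Ω) : opN k g y = y + g * y ^ q - y ^ (q ^ 2) := by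
  simp [opN, sq, pow_mul]

/-- The coefficient `g` for which `x` is a zero of `1 + g τ - τ²`. -/
noncomputable def gCoeff (k : Type u) [Fintype k] {Ω : Type w} [Field Ω] (x : Ω) : Ω :=
  (x ^ Fintype.card k)⁻¹ * (x ^ (Fintype.card k ^ 2) - x)

theorem opN_eq_zero_iff {g x : Ω} (hx : x ≠ 0) : opN k g x = 0 ↔ g = gCoeff k x := by
  have hxq : x ^ q ≠ 0 := pow_ne_zero _ hx
  rw [opN_apply, gCoeff, eq_inv_mul_iff_mul_eq₀ hxq]
  constructor <;> intro h <;> linear_combination h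

/-- The coefficient of `τ` in the product is `(x ^ (q - 1)) ^ q - x ^ (1 - q)`, which is `gCoeff k
x`. -/
theorem opU_mul_opP {x : Ω} (hx : x ≠ 0) : opU k x * opP k x = opN k (gCoeff k x) := by
  have h1 : x ^ (q - 1) ≠ 0 := pow_ne_zero _ hx
  have h2 : x ^ q ≠ 0 := pow_ne_zero _ hx
  have e1 : x ^ q = x ^ (q - 1) * x := (pow_card_pred_mul k x).symm
  have e2 : x ^ (q ^ 2) = (x ^ (q - 1)) ^ q * x ^ q := by
    rw [sq, pow_mul, e1, mul_pow, ← e1]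
  ext y
  simp only [Module.End.mul_apply, opU_apply, opP_apply, opN_apply, gCoeff]
  rw [pow_card_sub, e2, mul_pow, ← pow_mul y, ← sq]
  generalize (x ^ (q - 1)) ^ q = A at *
  rw [e1]
  field_simp
  ring

theorem opP_self (x : Ω) : opP k x x = 0 := by
  rw [opP_apply, pow_card_pred_mul, sub_self]

theorem opP_mul_opU {x : Ω} (hx : x ≠ 0) :
    opP k x * opU k x = opN k (x ^ (q - 1) - ((x ^ (q - 1)) ^ q)⁻¹) := by
  have h1 : x ^ (q - 1) ≠ 0 := pow_ne_zero _ hx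
  ext y
  simp only [Module.End.mul_apply, opU_apply, opP_apply, opN_apply]
  rw [pow_card_add, mul_pow, inv_pow, ← pow_mul y, ← sq]
  have h2 := pow_ne_zero q h1
  generalize (x ^ (q - 1)) ^ q = A at *
  field_simp
  ring

theorem ne_zero_of_opU_eq {x y : Ω} (hx : x ≠ 0) (h : opU k x y = x) : y ≠ 0 := by
  rintro rfl
  exact hx (by rw [← h, map_zero])

/-- `P_x U_x` kills `y`, because `P_x x = 0`; a nonzero zero determines the coefficient of `τ`. -/
theorem opP_mul_opU_of_opU_eq {x y : Ω} (hx : x ≠ 0) (h : opU k x y = x) :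
    opP k x * opU k x = opN k (gCoeff k y) := by
  rw [opP_mul_opU hx, ← (opN_eq_zero_iff (ne_zero_of_opU_eq hx h)).1]
  rw [← opP_mul_opU hx, Module.End.mul_apply, h, opP_self]

theorem opU_eq_iff {x y : Ω} (hx : x ≠ 0) :
    opU k x y = x ↔ (x * y) ^ q + x * y = x ^ (q + 1) := by
  have h1 : x ^ (q - 1) ≠ 0 := pow_ne_zero _ hx
  rw [opU_apply, mul_pow, pow_succ, ← pow_card_pred_mul k x]
  constructor
  · intro h
    nth_rewrite 5 [← h]
    field_simp
    ring
  · intro h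
    refine mul_left_cancel₀ (mul_ne_zero h1 hx) ?_
    rw [← h]
    field_simp
    ring

theorem gsRelation_iff {x y : Ω} (hx : x ≠ 0) :
    (∃ z : Ω, z ^ q + z = x ^ (q + 1) ∧ y = z / x) ↔ opU k x y = x := by
  rw [opU_eq_iff hx]
  constructor
  · rintro ⟨z, hz, rfl⟩
    rwa [mul_div_cancel₀ _ hx]
  · exact fun h ↦ ⟨x * y, h, by rw [mul_div_cancel_left₀ _ hx]⟩

/-- The ratio `y / x` is a root of `X ^ q - X`, which already splits in `k`. -/
theorem opP_eq_zero_iff {x y : Ω} (hx : x ≠ 0) : opP k x y = 0 ↔ ∃ c : k, y = c • x := by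
  constructor
  · intro h
    have h1 : (y / x) ^ q = y / x := by
      rw [opP_apply, sub_eq_zero] at h
      rw [div_pow, ← h, ← pow_card_pred_mul k x]
      field_simp
    have h2 : y / x ∈ (algebraMap k Ω).range := by
      have h3 : Splits (X ^ q - X : k[X]) := by
        simpa using (FiniteField.isSplittingField_sub k k).splits'
      refine h3.mem_range_of_isRoot
        (FiniteField.X_pow_card_sub_X_ne_zero k Fintype.one_lt_card) ?_
      simp [h1]
    obtain ⟨c, hc⟩ := h2
    exact ⟨c, by rw [Algebra.smul_def, hc, div_mul_cancel₀ _ hx]⟩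
  · rintro ⟨c, rfl⟩
    rw [map_smul, opP_self, smul_zero]

/-- `Y ^ q + b Y = c` is solvable over a separably closed field if `b` is nonzero. -/
theorem exists_pow_card_eq [IsSepClosed Ω] {b : Ω} (hb : b ≠ 0) (c : Ω) :
    ∃ y : Ω, y ^ q + b * y = c := by
  obtain ⟨y, hy⟩ := IsSepClosed.exists_root_C_mul_X_pow_add_C_mul_X_add_C (k := Ω)
    (n := q) 1 b (-c) (by
      rw [← map_natCast (algebraMap k Ω), Nat.cast_card_eq_zero, map_zero]) Fintype.one_lt_card hb
  exact ⟨y, by linear_combination hy⟩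

theorem opP_surjective [IsSepClosed Ω] {x : Ω} (hx : x ≠ 0) :
    Function.Surjective (opP k x) := fun b ↦ by
  obtain ⟨y, hy⟩ := exists_pow_card_eq (k := k) (neg_ne_zero.2 (pow_ne_zero (q - 1) hx)) (-b)
  exact ⟨y, by rw [opP_apply]; linear_combination -hy⟩

theorem opU_surjective [IsSepClosed Ω] {x : Ω} (hx : x ≠ 0) :
    Function.Surjective (opU k x) := fun b ↦ by
  obtain ⟨y, hy⟩ := exists_pow_card_eq (k := k) (inv_ne_zero (pow_ne_zero (q - 1) hx)) b
  exact ⟨y, by rw [opU_apply]; linear_combination hy⟩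

end Operators

theorem mul_aeval_eq_of_mul_eq {k : Type u} [Field k] {V : Type w} [AddCommGroup V] [Module k V]
    {c f f' : Module.End k V} (h : c * f = f' * c) (a : k[X]) :
    c * aeval f a = aeval f' a * c := by
  induction a using Polynomial.induction_on' with
  | add a b ha hb => simp only [map_add, mul_add, add_mul, ha, hb]
  | monomial n r =>
    have : c * f ^ n = f' ^ n * c := by
      have h' : SemiconjBy c f f' := h
      exact h'.pow_right n
    rw [aeval_monomial, aeval_monomial, mul_assoc, ← this, ← mul_assoc, ← mul_assoc,
      Algebra.commutes]

/-! ### Chains of isogenies and generators of their kernels -/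

section Sequences

variable {k : Type u} [Field k] [Fintype k] {Ω : Type w} [Field Ω] [Algebra k Ω]

local notation "q" => Fintype.card k

/-- The composition `P_{x (n - 1)} ∘ ⋯ ∘ P_{x 0}` for a sequence `x`. -/
noncomputable def opPSeq (k : Type u) [Field k] [Fintype k] {Ω : Type w} [Field Ω] [Algebra k Ω]
    (x : ℕ → Ω) (n : ℕ) : Module.End k Ω :=
  opPComp k n fun i : Fin n ↦ x i

@[simp]
theorem opPSeq_zero (x : ℕ → Ω) : opPSeq k x 0 = 1 := rfl

theorem opPSeq_succ (x : ℕ → Ω) (n : ℕ) : opPSeq k x (n + 1) = opP k (x n) * opPSeq k x n := rfl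

theorem opPSeq_succ_apply (x : ℕ → Ω) (n : ℕ) (y : Ω) :
    opPSeq k x (n + 1) y = opP k (x n) (opPSeq k x n y) := rfl

theorem opPSeq_congr {x x' : ℕ → Ω} {n : ℕ} (h : ∀ i < n, x i = x' i) :
    opPSeq k x n = opPSeq k x' n := by
  rw [opPSeq, opPSeq]
  congr 1
  ext i
  exact h i i.2

/-- The first `n + 1` terms of `x` satisfy the recursive relations `U_{x j} (x (j + 1)) = x j`. -/
structure IsGSSeq (k : Type u) [Field k] [Fintype k] {Ω : Type w} [Field Ω] [Algebra k Ω]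
    (n : ℕ) (x : ℕ → Ω) : Prop where
  zero_ne_zero : x 0 ≠ 0
  opU_eq : ∀ j < n, opU k (x j) (x (j + 1)) = x j

namespace IsGSSeq

variable {n : ℕ} {x : ℕ → Ω}

theorem mono (hx : IsGSSeq k n x) {m : ℕ} (h : m ≤ n) : IsGSSeq k m x :=
  ⟨hx.1, fun j hj ↦ hx.2 j (hj.trans_le h)⟩

theorem congr (hx : IsGSSeq k n x) {x' : ℕ → Ω} (h : ∀ i ≤ n, x i = x' i) : IsGSSeq k n x' :=
  ⟨h 0 n.zero_le ▸ hx.1, fun j hj ↦ by rw [← h j hj.le, ← h (j + 1) hj]; exact hx.2 j hj⟩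

theorem ne_zero (hx : IsGSSeq k n x) {j : ℕ} (hj : j ≤ n) : x j ≠ 0 := by
  induction j with
  | zero => exact hx.1
  | succ j ih => exact ne_zero_of_opU_eq (ih (by lia)) (hx.2 j hj)

/-- The partial compositions are isogenies: `P_{x j}` turns `U P` into `P U`, and the relation
identifies `P U` with the module attached to `x (j + 1)`. -/
theorem opPSeq_mul_opN (hx : IsGSSeq k n x) {j : ℕ} (hj : j ≤ n) :
    opPSeq k x j * opN k (gCoeff k (x 0)) = opN k (gCoeff k (x j)) * opPSeq k x j := by
  induction j with
  | zero => simp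
  | succ j ih =>
    rw [opPSeq_succ, mul_assoc, ih (by lia), ← opU_mul_opP (hx.ne_zero (by lia)),
      ← opP_mul_opU_of_opU_eq (hx.ne_zero (by lia)) (hx.2 j hj)]
    simp only [mul_assoc]

/-- The target module is left as `P U` here, since no relation beyond `x n` is assumed. -/
theorem opPSeq_succ_mul_opN (hx : IsGSSeq k n x) :
    opPSeq k x (n + 1) * opN k (gCoeff k (x 0)) =
      (opP k (x n) * opU k (x n)) * opPSeq k x (n + 1) := by
  rw [opPSeq_succ, mul_assoc, hx.opPSeq_mul_opN le_rfl, ← opU_mul_opP (hx.ne_zero le_rfl)]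
  simp only [mul_assoc]

/-- `φ_T` takes a distinguished generator of one level to one of the level below; this drives the
inductions. -/
theorem opPSeq_opN (hx : IsGSSeq k n x) {j : ℕ} (hj : j < n) {y : Ω}
    (hy : opPSeq k x (j + 1) y = x (j + 1)) :
    opPSeq k x j (opN k (gCoeff k (x 0)) y) = x j := by
  rw [← Module.End.mul_apply, hx.opPSeq_mul_opN hj.le, ← opU_mul_opP (hx.ne_zero hj.le), mul_assoc,
    ← opPSeq_succ, Module.End.mul_apply, hy, hx.2 j hj]

theorem opN_pow (hx : IsGSSeq k n x) {j : ℕ} (hj : j ≤ n) {y : Ω} (hy : opPSeq k x j y = x j) :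
    (opN k (gCoeff k (x 0)) ^ j) y = x 0 := by
  induction j generalizing y with
  | zero => simpa using hy
  | succ j ih =>
    rw [pow_succ, Module.End.mul_apply]
    exact ih (by lia) (hx.opPSeq_opN hj hy)

theorem opN_zero (hx : IsGSSeq k n x) : opN k (gCoeff k (x 0)) (x 0) = 0 :=
  (opN_eq_zero_iff hx.1).2 rfl

end IsGSSeq

/-- The submodule of zeros of `P_{x n} ∘ ⋯ ∘ P_{x 0}` is generated by each solution of
`(P_{x (n - 1)} ∘ ⋯ ∘ P_{x 0}) y = x n`. -/
theorem IsGSSeq.range_aeval_eq {n : ℕ} {x : ℕ → Ω} (hx : IsGSSeq k n x) {y : Ω}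
    (hy : opPSeq k x n y = x n) :
    Set.range (fun a : k[X] ↦ aeval (opN k (gCoeff k (x 0))) a y) =
      {w | opPSeq k x (n + 1) w = 0} := by
  apply subset_antisymm
  · rintro _ ⟨a, rfl⟩
    have h := mul_aeval_eq_of_mul_eq hx.opPSeq_succ_mul_opN a
    replace h := congrArg (fun f : Module.End k Ω ↦ f y) h
    simp only [Module.End.mul_apply] at h
    rw [Set.mem_ofPred_eq, h, opPSeq_succ_apply, hy, opP_self, map_zero]
  · intro w hw
    rw [Set.mem_ofPred_eq, opPSeq_succ_apply, opP_eq_zero_iff (hx.ne_zero le_rfl)] at hw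
    obtain ⟨c, hc⟩ := hw
    -- Subtracting `c y` moves `w` into the kernel of the shorter chain, which recursively is
    -- generated by `φ_T y`.
    have h1 : opPSeq k x n (w - c • y) = 0 := by rw [map_sub, map_smul, hy, hc, sub_self]
    cases n with
    | zero =>
      refine ⟨C c, ?_⟩
      have h2 : w = c • y := by simpa [sub_eq_zero] using h1
      simp [h2, Algebra.smul_def]
    | succ n =>
      have h2 := (hx.mono n.le_succ).range_aeval_eq (hx.opPSeq_opN n.lt_succ_self hy)
      have h3 : w - c • y ∈ {w | opPSeq k x (n + 1) w = 0} := h1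
      rw [← h2] at h3
      obtain ⟨a, ha⟩ := h3
      refine ⟨a * X + C c, ?_⟩
      simp only [map_add, map_mul, aeval_X, aeval_C, LinearMap.add_apply, Module.End.mul_apply,
        Module.algebraMap_end_apply] at ha ⊢
      rw [ha, sub_add_cancel]

theorem opPSeq_surjective [IsSepClosed Ω] {n : ℕ} {x : ℕ → Ω} (hx : ∀ j < n, x j ≠ 0) :
    Function.Surjective (opPSeq k x n) := by
  induction n with
  | zero => exact Function.surjective_id
  | succ n ih =>
    exact (opP_surjective (hx n n.lt_succ_self)).comp (ih fun j hj ↦ hx j (by lia))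

/-- A fibre of `P_{x n}` is a translate of the line `k x n`, so each step multiplies the count by
`q`. -/
theorem ncard_opPSeq_eq [IsSepClosed Ω] {n : ℕ} {x : ℕ → Ω} (hx : ∀ j < n, x j ≠ 0) (b : Ω) :
    {y | opPSeq k x n y = b}.ncard = q ^ n := by
  induction n generalizing b with
  | zero => simp
  | succ n ih =>
    replace ih := ih fun j hj ↦ hx j (by lia)
    have hn := hx n n.lt_succ_self
    obtain ⟨b', rfl⟩ := opP_surjective (k := k) hn b
    have h1 (c : k) : {y | opPSeq k x n y = b' + c • x n}.Finite :=
      Set.finite_of_ncard_ne_zero (by rw [ih]; exact pow_ne_zero _ Fintype.card_ne_zero)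
    have h2 : {y | opPSeq k x (n + 1) y = opP k (x n) b'} =
        ⋃ c : k, {y | opPSeq k x n y = b' + c • x n} := by
      ext y
      simp only [Set.mem_ofPred_eq, Set.mem_iUnion, opPSeq_succ_apply]
      rw [← sub_eq_zero, ← map_sub, opP_eq_zero_iff hn]
      simp only [sub_eq_iff_eq_add']
    rw [h2, Set.ncard_iUnion_of_finite h1]
    · rw [finsum_eq_sum_of_fintype]
      simp [ih, pow_succ, mul_comm]
    · intro c d hcd
      rw [Function.onFun, Set.disjoint_left]
      intro y (hc : _ = _) (hd : _ = _)
      rw [hc, add_right_inj] at hd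
      exact hcd (smul_left_injective k hn hd)

end Sequences

/-! ### Cyclic `k[X]`-modules killed by a power of `X` -/

section CyclicTorsion

variable {k : Type u} [Field k] {V : Type w} [AddCommGroup V] [Module k V]

theorem smul_aeval_of (f : Module.End k V) (a : k[X]) (y : V) :
    a • Module.AEval'.of f y = Module.AEval'.of f (aeval f a y) :=
  (Module.AEval.of_aeval_smul f a y).symm

/-- The elements `a` with `a(f) y = 0` are the multiples of `X ^ (n + 1)` if `f ^ (n + 1) y = 0` and
`f ^ n y ≠ 0`. -/
theorem aeval_apply_eq_zero_iff {f : Module.End k V} {n : ℕ} {y : V} (h0 : (f ^ (n + 1)) y = 0)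
    (h1 : (f ^ n) y ≠ 0) (a : k[X]) : aeval f a y = 0 ↔ X ^ (n + 1) ∣ a := by
  constructor
  · intro ha
    -- The annihilator is principal and contains `X ^ (n + 1)`, so its generator is a power of `X`
    -- up to a unit; `h1` excludes smaller exponents.
    let I : Ideal k[X] := Ideal.torsionOf k[X] (Module.AEval' f) (Module.AEval'.of f y)
    have hI (b : k[X]) : b ∈ I ↔ aeval f b y = 0 := by
      rw [Ideal.mem_torsionOf_iff, smul_aeval_of, EmbeddingLike.map_eq_zero_iff]
    obtain ⟨p, hp⟩ := (IsPrincipalIdealRing.principal I).principal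
    have hp' (b : k[X]) : p ∣ b ↔ aeval f b y = 0 := by
      rw [← hI, hp, Ideal.submodule_span_eq, Ideal.mem_span_singleton]
    have h2 : p ∣ X ^ (n + 1) := (hp' _).2 (by simpa using h0)
    obtain ⟨i, hi, hpi⟩ := (dvd_prime_pow prime_X _).1 h2
    have h3 : ¬ i ≤ n := fun h ↦ h1 <| by
      simpa using (hp' (X ^ n)).1 (hpi.dvd.trans (pow_dvd_pow _ h))
    obtain rfl : i = n + 1 := by lia
    exact hpi.symm.dvd.trans ((hp' a).2 ha)
  · rintro ⟨b, rfl⟩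
    rw [mul_comm, map_mul, Module.End.mul_apply, map_pow, aeval_X, h0, map_zero]

/-- The kernel of `f` on the cyclic module is a line: `X a` is divisible by `X ^ (n + 1)`, so `a = X
^ n b`, and only the constant term of `b` acts. -/
theorem exists_smul_eq_of_mem_range {f : Module.End k V} {n : ℕ} {x y : V}
    (h0 : (f ^ (n + 1)) y = 0) (h1 : (f ^ n) y ≠ 0)
    (hx : x ∈ Set.range fun a : k[X] ↦ aeval f a y) (hfx : f x = 0) :
    ∃ c : k, x = c • (f ^ n) y := by
  obtain ⟨a, rfl⟩ := hx
  have h2 : aeval f (X * a) y = 0 := by simpa using hfx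
  rw [aeval_apply_eq_zero_iff h0 h1, pow_succ', mul_dvd_mul_iff_left X_ne_zero] at h2
  obtain ⟨b, rfl⟩ := h2
  refine ⟨b.coeff 0, ?_⟩
  nth_rewrite 1 [← divX_mul_X_add b]
  rw [mul_add, mul_comm, mul_assoc, ← pow_succ']
  simp [h0]

/-- The generator corresponds to the class of `1`; the two conditions on it say that its annihilator
is exactly `(X ^ (n + 1))`. -/
theorem exists_submodule_iff {f : Module.End k V} {n : ℕ} {G : Set V} :
    (∃ M : Submodule k[X] (Module.AEval' f),
      Nonempty (M ≃ₗ[k[X]] (k[X] ⧸ Ideal.span {(X : k[X]) ^ (n + 1)})) ∧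
      ∀ y : V, y ∈ G ↔ Module.AEval'.of f y ∈ M) ↔
    ∃ y : V, (f ^ (n + 1)) y = 0 ∧ (f ^ n) y ≠ 0 ∧ G = Set.range fun a : k[X] ↦ aeval f a y := by
  constructor
  · rintro ⟨M, ⟨e⟩, hM⟩
    obtain ⟨y, hy⟩ := (Module.AEval'.of f).surjective (e.symm 1 : M)
    have key (a : k[X]) : Module.AEval'.of f (aeval f a y) =
        (e.symm (Ideal.Quotient.mk _ a) : M) := by
      have h : a • (1 : k[X] ⧸ Ideal.span {(X : k[X]) ^ (n + 1)}) = Ideal.Quotient.mk _ a :=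
        congrArg (Ideal.Quotient.mk _) (mul_one a)
      rw [← smul_aeval_of, hy, ← Submodule.coe_smul, ← map_smul, h]
    have key' (a : k[X]) : aeval f a y = 0 ↔ X ^ (n + 1) ∣ a := by
      rw [← Ideal.mem_span_singleton, ← Ideal.Quotient.eq_zero_iff_mem,
        ← EmbeddingLike.map_eq_zero_iff (f := e.symm), ← Submodule.coe_eq_zero, ← key,
        EmbeddingLike.map_eq_zero_iff (f := Module.AEval'.of f)]
    refine ⟨y, ?_, ?_, ?_⟩
    · simpa using (key' (X ^ (n + 1))).2 dvd_rfl
    · have h := (key' (X ^ n)).not.2 fun h ↦ by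
        simpa using (pow_dvd_pow_iff X_ne_zero not_isUnit_X).1 h
      simpa using h
    · ext z
      rw [hM, Set.mem_range]
      constructor
      · intro hz
        obtain ⟨a, ha⟩ := Ideal.Quotient.mk_surjective (e ⟨_, hz⟩)
        refine ⟨a, (Module.AEval'.of f).injective ?_⟩
        rw [key, ha, LinearEquiv.symm_apply_apply]
      · rintro ⟨a, rfl⟩
        rw [key]
        exact (e.symm (Ideal.Quotient.mk _ a)).2
  · rintro ⟨y, h0, h1, rfl⟩
    have h2 : Ideal.torsionOf k[X] (Module.AEval' f) (Module.AEval'.of f y) =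
        Ideal.span {(X : k[X]) ^ (n + 1)} := by
      ext a
      rw [Ideal.mem_torsionOf_iff, Ideal.mem_span_singleton, ← aeval_apply_eq_zero_iff h0 h1,
        smul_aeval_of, EmbeddingLike.map_eq_zero_iff]
    refine ⟨Submodule.span k[X] {Module.AEval'.of f y},
      ⟨(Ideal.quotTorsionOfEquivSpanSingleton k[X] _ _).symm ≪≫ₗ
        Submodule.quotEquivOfEq _ _ h2⟩, fun z ↦ ?_⟩
    simp only [Submodule.mem_span_singleton, Set.mem_range, smul_aeval_of,
      EmbeddingLike.apply_eq_iff_eq]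

end CyclicTorsion

/-! ### Level structures and sequences of coordinates -/

section LevelStructure

variable {k : Type u} [Field k] [Fintype k] {L : Type v} [Field L] {Ω : Type w} [Field Ω]
  [Algebra k L] [Algebra k Ω] [Algebra L Ω] [IsScalarTower k L Ω]

local notation "q" => Fintype.card k

theorem opT_normalized (g : L) :
    (DrinfeldModule.normalized g).opT k Ω = opN k (algebraMap L Ω g) := by
  ext y
  simp [DrinfeldModule.opT, DrinfeldModule.normalized, Algebra.smul_def, sq, pow_mul,
    sub_eq_add_neg]

theorem DrinfeldModule.IsNormalized.eq_normalized {φ : DrinfeldModule L} (h : φ.IsNormalized) :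
    φ = .normalized φ.g := by
  ext
  exacts [h.1, rfl, h.2]

/-- The zeros of `P_{x n} ∘ ⋯ ∘ P_{x 0}`. -/
def seqZeros (k : Type u) [Field k] [Fintype k] {Ω : Type w} [Field Ω] [Algebra k Ω]
    (x : ℕ → Ω) (n : ℕ) : Set Ω :=
  {y | opPSeq k x (n + 1) y = 0}

theorem seqZeros_congr {x x' : ℕ → Ω} {n : ℕ} (h : ∀ i ≤ n, x i = x' i) :
    seqZeros k x n = seqZeros k x' n := by
  rw [seqZeros, opPSeq_congr fun i hi ↦ h i (Nat.lt_succ_iff.1 hi), seqZeros]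

theorem IsGSSeq.isLevelStructure [IsSepClosed Ω] {n : ℕ} {x : ℕ → Ω} (hx : IsGSSeq k n x)
    {φ : DrinfeldModule L} (hφ : φ.opT k Ω = opN k (gCoeff k (x 0))) :
    φ.IsLevelStructure k (n + 1) (x 0) (seqZeros k x n) := by
  obtain ⟨y, hy⟩ := opPSeq_surjective (k := k) (fun j (hj : j < n) ↦ hx.ne_zero hj.le) (x n)
  have h1 := hx.opN_pow le_rfl hy
  have h2 := hx.range_aeval_eq hy
  refine ⟨hx.1, by rw [hφ, hx.opN_zero], ?_, ?_⟩
  · refine exists_submodule_iff.2 ⟨y, ?_, ?_, ?_⟩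
    · rw [hφ, pow_succ', Module.End.mul_apply, h1, hx.opN_zero]
    · rw [hφ, h1]
      exact hx.1
    · rw [hφ, h2, seqZeros]
  · rw [seqZeros, ← h2]
    exact ⟨X ^ n, by simpa using h1⟩

theorem IsGSSeq.image_opN [IsSepClosed Ω] {n : ℕ} {x : ℕ → Ω} (hx : IsGSSeq k (n + 1) x) :
    opN k (gCoeff k (x 0)) '' seqZeros k x (n + 1) = seqZeros k x n := by
  obtain ⟨y, hy⟩ := opPSeq_surjective (k := k) (fun j (hj : j < n + 1) ↦ hx.ne_zero hj.le)
    (x (n + 1))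
  rw [seqZeros, seqZeros, ← hx.range_aeval_eq hy,
    ← (hx.mono n.le_succ).range_aeval_eq (hx.opPSeq_opN n.lt_succ_self hy), ← Set.range_comp]
  congr 1
  ext a
  simp only [Function.comp_apply, ← Module.End.mul_apply]
  rw [(Algebra.commute_of_mem_adjoin_self (aeval_mem_adjoin_singleton _ _)).eq]

/-- A level structure comes from a sequence satisfying the recursive relations. -/
theorem DrinfeldModule.IsLevelStructure.exists_isGSSeq {φ : DrinfeldModule L} {g : Ω} {n : ℕ}
    {x₁ : Ω} {G : Set Ω} (hφ : φ.opT k Ω = opN k g) (h : φ.IsLevelStructure k (n + 1) x₁ G) :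
    g = gCoeff k x₁ ∧ ∃ x : ℕ → Ω, IsGSSeq k n x ∧ x 0 = x₁ ∧ G = seqZeros k x n := by
  obtain ⟨h0, htor, hcyc, hmem⟩ := h
  rw [hφ] at htor
  have hg := (opN_eq_zero_iff h0).1 htor
  refine ⟨hg, ?_⟩
  obtain ⟨y', hy', hy0', rfl⟩ := exists_submodule_iff.1 hcyc
  rw [hφ] at hy' hy0' hmem ⊢
  -- The torsion point is a scalar multiple of `φ_T ^ n y'`; rescaling the generator makes the two
  -- equal.
  obtain ⟨c, hc⟩ := exists_smul_eq_of_mem_range hy' hy0' hmem htor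
  have hc0 : c ≠ 0 := by
    rintro rfl
    exact h0 (by rw [hc, zero_smul])
  obtain ⟨y, rfl⟩ : ∃ y, y' = c⁻¹ • y := ⟨c • y', by rw [inv_smul_smul₀ hc0]⟩
  rw [map_smul, smul_inv_smul₀ hc0] at hc
  have hrange : Set.range (fun a : k[X] ↦ aeval (opN k g) a (c⁻¹ • y)) =
      Set.range (fun a : k[X] ↦ aeval (opN k g) a y) := by
    apply subset_antisymm
    · rintro _ ⟨a, rfl⟩
      exact ⟨C c⁻¹ * a, by simp⟩
    · rintro _ ⟨a, rfl⟩
      exact ⟨C c * a, by simp [smul_smul, hc0]⟩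
  -- The term `x j` involves only earlier terms, through the composition. The recursion therefore
  -- builds the operators `c j` first and reads off `x j` from them.
  have hex : ∃ x : ℕ → Ω, ∀ j, x j = opPSeq k x j ((opN k g ^ (n - j)) y) := by
    let c : ℕ → Module.End k Ω := fun j ↦
      Nat.rec 1 (fun i d ↦ opP k (d ((opN k g ^ (n - i)) y)) * d) j
    have hc (j : ℕ) : opPSeq k (fun j ↦ c j ((opN k g ^ (n - j)) y)) j = c j := by
      induction j with
      | zero => rfl
      | succ j ih => rw [opPSeq_succ, ih]
    exact ⟨fun j ↦ c j ((opN k g ^ (n - j)) y), fun j ↦ by rw [hc]⟩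
  obtain ⟨x, hx⟩ := hex
  have hx0 : x 0 = x₁ := by simpa [hc] using hx 0
  have hseq (m : ℕ) (hm : m ≤ n) : IsGSSeq k m x := by
    induction m with
    | zero => exact ⟨hx0 ▸ h0, by simp⟩
    | succ m ih =>
      have hm' := ih (by lia)
      refine ⟨hx0 ▸ h0, fun j hj ↦ ?_⟩
      obtain hj | rfl := Nat.lt_succ_iff_lt_or_eq.1 hj
      · exact hm'.2 j hj
      -- Pushing `φ_T` through the composition and writing the `j`-th module as `U P` yields `U_{x
      -- j} (x (j + 1)) = x j`.
      · have h1 : (opN k g ^ (n - j)) y = opN k g ((opN k g ^ (n - (j + 1))) y) := by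
          rw [← Module.End.mul_apply, ← pow_succ']
          congr 2
          lia
        have h2 := hm'.opPSeq_mul_opN le_rfl
        rw [hx0, ← hg, ← opU_mul_opP (hm'.ne_zero le_rfl), mul_assoc, ← opPSeq_succ] at h2
        rw [hx (j + 1), ← Module.End.mul_apply, ← h2, Module.End.mul_apply, ← h1, ← hx]
  refine ⟨x, hseq n le_rfl, hx0, ?_⟩
  rw [hrange, seqZeros, ← (hseq n le_rfl).range_aeval_eq (y := y), hx0, hg]
  simpa using (hx n).symm

/-- A sequence satisfying the recursive relations is determined by its level structure. -/
theorem IsGSSeq.eq_of_seqZeros_eq [IsSepClosed Ω] {n : ℕ} {x x' : ℕ → Ω} (hx : IsGSSeq k n x)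
    (hx' : IsGSSeq k n x') (h0 : x 0 = x' 0) (h : seqZeros k x n = seqZeros k x' n) {j : ℕ}
    (hj : j ≤ n) : x j = x' j := by
  induction n generalizing j with
  | zero => rwa [Nat.le_zero.1 hj]
  | succ n ih =>
    -- Applying `φ_T` to the common group gives the common group one level down.
    have h1 : ∀ j ≤ n, x j = x' j := fun j hj ↦ by
      refine ih (hx.mono n.le_succ) (hx'.mono n.le_succ) ?_ hj
      rw [← hx.image_opN, ← hx'.image_opN, h, h0]
    obtain hj | rfl := Nat.le_succ_iff.1 hj
    · exact h1 j hj
    have h2 : opPSeq k x (n + 1) = opPSeq k x' (n + 1) :=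
      opPSeq_congr fun i hi ↦ h1 i (Nat.lt_succ_iff.1 hi)
    -- The point `y` of the common group shows that the last coordinates differ by a scalar `c`;
    -- applying `U_{x n}` to both gives `c = 1`.
    obtain ⟨y, hy⟩ := opPSeq_surjective (k := k) (fun j (hj : j < n + 1) ↦ hx.ne_zero hj.le)
      (x (n + 1))
    have h3 : y ∈ seqZeros k x (n + 1) := by
      change opP k (x (n + 1)) (opPSeq k x (n + 1) y) = 0
      rw [hy, opP_self]
    rw [h] at h3
    change opP k (x' (n + 1)) (opPSeq k x' (n + 1) y) = 0 at h3
    rw [← h2, hy, opP_eq_zero_iff (hx'.ne_zero le_rfl)] at h3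
    obtain ⟨c, hc⟩ := h3
    have h4 := hx.2 n n.lt_succ_self
    rw [hc, h1 n le_rfl, map_smul, hx'.2 n n.lt_succ_self] at h4
    have h5 : c = 1 := smul_left_injective k (hx'.ne_zero n.le_succ) (by simpa using h4)
    rw [hc, h5, one_smul]

end LevelStructure

/-! ### From sequences to finite tuples -/

section Tuples

variable {k : Type u} [Field k] [Fintype k] {Ω : Type w} [Field Ω] [Algebra k Ω]

local notation "q" => Fintype.card k

/-- Extension of a tuple by zero to a sequence. -/
def seqOfTuple {Ω : Type w} [Zero Ω] {n : ℕ} (x : Fin (n + 1) → Ω) (i : ℕ) : Ω :=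
  if h : i < n + 1 then x ⟨i, h⟩ else 0

@[simp]
theorem seqOfTuple_coe {Ω : Type w} [Zero Ω] {n : ℕ} (x : Fin (n + 1) → Ω) (i : Fin (n + 1)) :
    seqOfTuple x i = x i :=
  dif_pos i.2

@[simp]
theorem seqOfTuple_zero {Ω : Type w} [Zero Ω] {n : ℕ} (x : Fin (n + 1) → Ω) :
    seqOfTuple x 0 = x 0 := by
  simp [seqOfTuple]

theorem mem_gsCurve_iff {n : ℕ} {x : ℕ → Ω} :
    (fun i : Fin (n + 1) ↦ x i) ∈ gsCurve q Ω n ↔ IsGSSeq k n x := by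
  constructor
  · rintro ⟨h0, h⟩
    -- Rewriting the relation at `j` needs `x j ≠ 0`, which follows from the preceding relations;
    -- hence the induction.
    have hne (m : ℕ) (hm : m ≤ n) : IsGSSeq k m x := by
      induction m with
      | zero => exact ⟨h0, by simp⟩
      | succ m ih =>
        refine ⟨h0, fun j hj ↦ ?_⟩
        obtain hj | rfl := Nat.lt_succ_iff_lt_or_eq.1 hj
        · exact (ih (by lia)).2 j hj
        · exact (gsRelation_iff ((ih (by lia)).ne_zero le_rfl)).1 (h ⟨j, hm⟩)
    exact hne n le_rfl
  · intro h
    exact ⟨h.1, fun j ↦ (gsRelation_iff (h.ne_zero j.2.le)).2 (h.2 j j.2)⟩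

theorem tuple_mem_gsCurve_iff {n : ℕ} {x : Fin (n + 1) → Ω} :
    x ∈ gsCurve q Ω n ↔ IsGSSeq k n (seqOfTuple x) := by
  rw [← mem_gsCurve_iff]
  simp

theorem zerosP_coe {n : ℕ} (x : ℕ → Ω) :
    zerosP k (fun i : Fin (n + 1) ↦ x i) = seqZeros k x n := rfl

theorem zerosP_eq_seqZeros {n : ℕ} (x : Fin (n + 1) → Ω) :
    zerosP k x = seqZeros k (seqOfTuple x) n := by
  rw [← zerosP_coe]
  simp

theorem opPComp_init {n : ℕ} (x : Fin (n + 1) → Ω) :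
    opPComp k n (Fin.init x) = opPSeq k (seqOfTuple x) n := by
  rw [opPSeq]
  congr 1
  ext i
  exact (seqOfTuple_coe x i.castSucc).symm

theorem zerosP_init {n : ℕ} (x : Fin (n + 2) → Ω) :
    zerosP k (Fin.init x) = seqZeros k (seqOfTuple x) n := by
  rw [zerosP, opPComp_init, seqZeros]

end Tuples

theorem comp_seqOfTuple {L : Type v} [Field L] {Ω : Type w} [Field Ω] (f : L →+* Ω)
    {n : ℕ} (x : Fin (n + 1) → L) : f ∘ seqOfTuple x = seqOfTuple (f ∘ x) := by
  ext i
  by_cases hi : i < n + 1 <;> simp [seqOfTuple, hi]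

/-! ### Behaviour under field homomorphisms -/

section Functoriality

variable {k : Type u} [Field k] [Fintype k] {L : Type v} [Field L] {Ω : Type w} [Field Ω]
  [Algebra k Ω]

local notation "q" => Fintype.card k

/-- The relations involve only powers, so `f` need not be `k`-linear. -/
theorem isGSSeq_comp_iff [Algebra k L] (f : L →+* Ω) {n : ℕ} {x : ℕ → L} :
    IsGSSeq k n (f ∘ x) ↔ IsGSSeq k n x := by
  have h (a b : L) : opU k (f a) (f b) = f a ↔ opU k a b = a := by
    rw [← f.injective.eq_iff (b := a)]
    simp
  constructor
  · exact fun hx ↦ ⟨fun h0 ↦ hx.1 (by simp [h0]), fun j hj ↦ (h _ _).1 (hx.2 j hj)⟩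
  · exact fun hx ↦ ⟨by simpa using hx.1, fun j hj ↦ (h _ _).2 (hx.2 j hj)⟩

variable (k) in
theorem gsCurve_comp_iff [Algebra k L] (f : L →+* Ω) {n : ℕ} {x : Fin (n + 1) → L} :
    f ∘ x ∈ gsCurve q Ω n ↔ x ∈ gsCurve q L n := by
  rw [tuple_mem_gsCurve_iff, tuple_mem_gsCurve_iff, ← comp_seqOfTuple, isGSSeq_comp_iff]

variable [Algebra L Ω]

theorem map_opPSeq (σ : Ω ≃ₐ[L] Ω) (x : ℕ → Ω) (n : ℕ) (y : Ω) :
    σ (opPSeq k x n y) = opPSeq k (σ ∘ x) n (σ y) := by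
  induction n with
  | zero => rfl
  | succ n ih => simp [opPSeq_succ_apply, ih]

theorem image_seqZeros (σ : Ω ≃ₐ[L] Ω) (x : ℕ → Ω) (n : ℕ) :
    σ '' seqZeros k x n = seqZeros k (σ ∘ x) n := by
  ext y
  obtain ⟨y, rfl⟩ := σ.surjective y
  rw [σ.injective.mem_set_image]
  simp only [seqZeros, Set.mem_ofPred_eq, ← map_opPSeq, EmbeddingLike.map_eq_zero_iff]

theorem IsGSSeq.map {n : ℕ} {x : ℕ → Ω} (hx : IsGSSeq k n x) (σ : Ω ≃ₐ[L] Ω) :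
    IsGSSeq k n (σ ∘ x) :=
  (isGSSeq_comp_iff (σ : Ω →+* Ω)).2 hx

theorem ncard_generators [Algebra k L] [IsSepClosed Ω] {n : ℕ} {x : Fin (n + 1) → L}
    (hx : x ∈ gsCurve q L n) :
    {y : Ω | opPComp k n (Fin.init (algebraMap L Ω ∘ x)) y =
      algebraMap L Ω (x (Fin.last n))}.ncard = q ^ n := by
  have hx' := tuple_mem_gsCurve_iff.1 ((gsCurve_comp_iff k (algebraMap L Ω)).2 hx)
  rw [opPComp_init]
  exact ncard_opPSeq_eq (fun j hj ↦ hx'.ne_zero hj.le) _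

end Functoriality

/-- An element of a normal extension that is fixed by all automorphisms and satisfies
`y ^ q + b y = c` with `b ≠ 0` and `b`, `c` in the base field lies in the base field. -/
theorem mem_range_of_fixed {k : Type u} [Field k] [Fintype k] {L : Type v} [Field L] {Ω : Type w}
    [Field Ω] [Algebra k L] [Algebra L Ω] [Normal L Ω] {b c : L} (hb : b ≠ 0) {y : Ω}
    (hy : y ^ Fintype.card k + algebraMap L Ω b * y = algebraMap L Ω c)
    (h : ∀ σ : Ω ≃ₐ[L] Ω, σ y = y) :
    y ∈ (algebraMap L Ω).range := by
  have hq : (Fintype.card k : L) = 0 := by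
    rw [← map_natCast (algebraMap k L), Nat.cast_card_eq_zero, map_zero]
  have hsep := separable_C_mul_X_pow_add_C_mul_X_add_C 1 b (-c) hq hb.isUnit
  have hdvd : minpoly L y ∣ C 1 * X ^ Fintype.card k + C b * X + C (-c) :=
    minpoly.dvd _ _ (by simp [hy])
  have hint : IsIntegral L y := Algebra.IsIntegral.isIntegral y
  -- All conjugates of `y` equal `y`; by separability the number of roots is the degree, which is
  -- therefore `1`.
  have hroots : (minpoly L y).rootSet Ω = {y} := by
    ext z
    rw [mem_rootSet_of_ne (minpoly.ne_zero hint), Set.mem_singleton_iff]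
    constructor
    · intro hz
      obtain ⟨σ, hσ⟩ := (Normal.minpoly_eq_iff_mem_orbit Ω).1
        (minpoly.eq_of_irreducible_of_monic (minpoly.irreducible hint) hz (minpoly.monic hint))
      exact σ.injective (hσ.trans (h σ).symm)
    · rintro rfl
      exact minpoly.aeval L z
  have hcard := card_rootSet_eq_natDegree (hsep.of_dvd hdvd) (Normal.splits ‹_› y)
  rw [Fintype.card_eq_nat_card, hroots] at hcard
  exact minpoly.natDegree_eq_one_iff.1 (by simpa using hcard.symm)

/-! ### The moduli problem over an arbitrary field -/

section Moduli

variable {k : Type u} [Field k] [Fintype k] {L : Type v} [Field L] {Ω : Type w} [Field Ω]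
  [Algebra k L] [Algebra k Ω] [Algebra L Ω] [IsScalarTower k L Ω]

local notation "q" => Fintype.card k

theorem opT_tModule (x : L) :
    (tModule q x).opT k Ω = opN k (gCoeff k (algebraMap L Ω x)) := by
  rw [tModule, opT_normalized]
  simp [gCoeff]

theorem eq_tModule {φ : DrinfeldModule L} (hφ : φ.IsNormalized) {x : L} (hx : x ≠ 0)
    (h : φ.opT k Ω (algebraMap L Ω x) = 0) : φ = tModule q x := by
  rw [hφ.eq_normalized] at h ⊢
  rw [opT_normalized, opN_eq_zero_iff (by simpa using hx)] at h
  rw [tModule]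
  congr 1
  apply (algebraMap L Ω).injective
  simpa [gCoeff] using h

theorem isModuliPoint_of_mem_gsCurve [IsSepClosed Ω] {n : ℕ} {x : Fin (n + 1) → L}
    (hx : x ∈ gsCurve q L n) :
    (tModule q (x 0)).IsModuliPoint k (n + 1) (x 0) (zerosP k (algebraMap L Ω ∘ x)) := by
  have hx' := tuple_mem_gsCurve_iff.1 ((gsCurve_comp_iff k (algebraMap L Ω)).2 hx)
  have hx0 : seqOfTuple (algebraMap L Ω ∘ x) 0 = algebraMap L Ω (x 0) := by simp
  rw [zerosP_eq_seqZeros]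
  refine ⟨⟨rfl, rfl⟩, ?_, fun σ y hy ↦ ?_⟩
  · rw [← hx0]
    exact hx'.isLevelStructure (by rw [opT_tModule, hx0])
  · have h1 : σ ∘ seqOfTuple (algebraMap L Ω ∘ x) = seqOfTuple (algebraMap L Ω ∘ x) := by
      ext i
      by_cases hi : i < n + 1 <;> simp [seqOfTuple, hi]
    rw [← h1, ← image_seqZeros]
    exact ⟨y, hy, rfl⟩

/-- The coordinates exist uniquely over `Ω`, so they are fixed by automorphisms. Since `Ω / L` may
be inseparable, descent to `L` goes one coordinate at a time, by separable equations. -/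
theorem existsUnique_of_isModuliPoint [IsSepClosed Ω] [Normal L Ω] {n : ℕ} {φ : DrinfeldModule L}
    {x₁ : L} {G : Set Ω} (h : φ.IsModuliPoint k (n + 1) x₁ G) :
    ∃! x : Fin (n + 1) → L, x ∈ gsCurve q L n ∧
      φ = tModule q (x 0) ∧ x₁ = x 0 ∧ G = zerosP k (algebraMap L Ω ∘ x) := by
  have hx₁ : x₁ ≠ 0 := by simpa using h.level.ne_zero
  obtain ⟨-, x, hx, hx0, hG⟩ := h.level.exists_isGSSeq
    (by rw [h.normalized.eq_normalized, opT_normalized])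
  have hfix (σ : Ω ≃ₐ[L] Ω) (j : ℕ) (hj : j ≤ n) : σ (x j) = x j := by
    refine (hx.map σ).eq_of_seqZeros_eq hx (by simp [hx0]) ?_ hj
    rw [← image_seqZeros, ← hG]
    apply subset_antisymm
    · rintro _ ⟨y, hy, rfl⟩
      exact h.stable σ y hy
    · intro y hy
      exact ⟨σ.symm y, h.stable σ.symm y hy, by simp⟩
  have hrat (j : ℕ) (hj : j ≤ n) : x j ∈ (algebraMap L Ω).range := by
    induction j with
    | zero => exact ⟨x₁, hx0.symm⟩
    | succ j ih =>
      obtain ⟨a, ha⟩ := ih (by lia)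
      have ha0 : a ≠ 0 := by
        rintro rfl
        exact hx.ne_zero (by lia) (ha.symm.trans (map_zero _))
      -- With `a` the previous coordinate, the relation reads `y ^ q + a ^ (1 - q) y = a`.
      refine mem_range_of_fixed (k := k) (b := (a ^ (q - 1))⁻¹) (c := a)
        (inv_ne_zero (pow_ne_zero _ ha0)) ?_ fun σ ↦ hfix σ _ hj
      rw [map_inv₀, map_pow, ha, add_comm, ← opU_apply, hx.2 j hj]
  choose! t ht using hrat
  have ht' : algebraMap L Ω ∘ (fun i : Fin (n + 1) ↦ t i) = fun i : Fin (n + 1) ↦ x i := by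
    ext i
    exact ht i (Nat.lt_succ_iff.1 i.2)
  have ht0 : t 0 = x₁ := (algebraMap L Ω).injective (by rw [ht 0 n.zero_le, hx0])
  refine ⟨fun i ↦ t i, ⟨?_, ?_, ht0.symm, ?_⟩, ?_⟩
  · rw [← gsCurve_comp_iff k (algebraMap L Ω), ht']
    exact mem_gsCurve_iff.2 hx
  · have := eq_tModule (k := k) (Ω := Ω) h.normalized hx₁ h.level.torsion
    rwa [← ht0] at this
  · rw [ht', zerosP_coe, hG]
  · rintro s ⟨hs, -, hs0, hGs⟩
    ext i
    apply (algebraMap L Ω).injective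
    have hs' := tuple_mem_gsCurve_iff.1 ((gsCurve_comp_iff k (algebraMap L Ω)).2 hs)
    rw [zerosP_eq_seqZeros] at hGs
    have := hs'.eq_of_seqZeros_eq hx (by simp [← hs0, hx0]) (hGs.symm.trans hG)
      (Nat.lt_succ_iff.1 i.2)
    simp only [seqOfTuple_coe, Function.comp_apply] at this
    rw [this, ht i (Nat.lt_succ_iff.1 i.2)]

theorem range_action_eq {n : ℕ} {x : Fin (n + 1) → L} (hx : x ∈ gsCurve q L n) {y : Ω}
    (hy : opPComp k n (Fin.init (algebraMap L Ω ∘ x)) y = algebraMap L Ω (x (Fin.last n))) :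
    Set.range (fun a ↦ (tModule q (x 0)).action k Ω a y) = zerosP k (algebraMap L Ω ∘ x) := by
  have hx' := tuple_mem_gsCurve_iff.1 ((gsCurve_comp_iff k (algebraMap L Ω)).2 hx)
  have h1 := seqOfTuple_coe (algebraMap L Ω ∘ x) (Fin.last n)
  rw [Fin.val_last] at h1
  rw [opPComp_init] at hy
  have := hx'.range_aeval_eq (hy.trans h1.symm)
  rw [zerosP_eq_seqZeros, seqZeros, ← this]
  simp [DrinfeldModule.action, opT_tModule]

theorem image_opT_zerosP [IsSepClosed Ω] {n : ℕ} {x : Fin (n + 2) → L}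
    (hx : x ∈ gsCurve q L (n + 1)) :
    (tModule q (x 0)).opT k Ω '' zerosP k (algebraMap L Ω ∘ x) =
      zerosP k (Fin.init (algebraMap L Ω ∘ x)) := by
  have hx' := tuple_mem_gsCurve_iff.1 ((gsCurve_comp_iff k (algebraMap L Ω)).2 hx)
  have := hx'.image_opN
  rw [seqOfTuple_zero] at this
  rw [zerosP_eq_seqZeros, zerosP_init, ← this, opT_tModule, Function.comp_apply]

end Moduli

/-! ### Valuations and total ramification -/

section Ramification

variable {Γ : Type*} [LinearOrderedCommGroupWithZero Γ]

/-- If the values of `F` are powers of `c ^ N` and `z` has the value `c ^ a` with `a` prime to `N`,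
then a nonzero polynomial expression in `z` of degree less than `N` has as its value a power
of `c`. -/
theorem exists_valuation_aeval_eq_zpow {F Ω : Type*} [Field F] [Field Ω] [Algebra F Ω]
    {v : Valuation Ω Γ} {c : Γ} (hc : 1 < c) {N a : ℕ} (ha : a.Coprime N)
    (hF : ∀ r : F, r ≠ 0 → ∃ m : ℤ, v (algebraMap F Ω r) = c ^ (N * m)) {z : Ω}
    (hz : v z = c ^ a) {p : F[X]} (hp : p ≠ 0) (hdeg : p.natDegree < N) :
    ∃ m : ℤ, v (aeval z p) = c ^ m := by
  have hc0 : c ≠ 0 := (zero_lt_one.trans hc).ne'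
  choose! m hm using hF
  let e : ℕ → ℤ := fun i ↦ N * m (p.coeff i) + a * i
  have he (i : ℕ) (hi : i ∈ p.support) : v (algebraMap F Ω (p.coeff i) * z ^ i) = c ^ e i := by
    rw [map_mul, map_pow, hz, hm _ (mem_support_iff.1 hi), zpow_add₀ hc0, ← pow_mul,
      ← zpow_natCast c (a * i), Nat.cast_mul]
  -- Exponents of different terms are distinct modulo `N`, since `a` is prime to `N` and `i`, `j`
  -- are below `N`.
  have hinj (i : ℕ) (hi : i ∈ p.support) (j : ℕ) (hj : j ∈ p.support) (h : e i = e j) : i = j := by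
    have h1 : (N : ℤ) ∣ a * ((i : ℤ) - j) :=
      ⟨m (p.coeff j) - m (p.coeff i), by simp only [e] at h; linear_combination h⟩
    have h2 : (N : ℤ) ∣ (i : ℤ) - j :=
      (Nat.isCoprime_iff_coprime.2 ha.symm).dvd_of_dvd_mul_left h1
    have hi' := (le_natDegree_of_mem_supp i hi).trans_lt hdeg
    have hj' := (le_natDegree_of_mem_supp j hj).trans_lt hdeg
    have h3 := Int.eq_zero_of_abs_lt_dvd h2 (by rw [abs_lt]; lia)
    lia
  obtain ⟨i, hi, hmax⟩ := p.support.exists_max_image e (nonempty_support_iff.2 hp)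
  refine ⟨e i, ?_⟩
  rw [aeval_def, eval₂_eq_sum, Polynomial.sum, v.map_sum_eq_of_lt hi, he i hi]
  intro j hj
  rw [Finset.mem_sdiff, Finset.mem_singleton] at hj
  rw [he i hi, he j hj.1]
  exact zpow_lt_zpow_right₀ hc
    ((hmax j hj.1).lt_of_ne fun h ↦ hj.2 (hinj j hj.1 i hi h))

/-- A totally ramified element: its equation of degree `N` is the minimal polynomial. -/
theorem minpoly_eq_of_valuation {F Ω : Type*} [Field F] [Field Ω] [Algebra F Ω]
    {v : Valuation Ω Γ} {c : Γ} (hc : 1 < c) {N a : ℕ} (ha : a.Coprime N)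
    (hF : ∀ r : F, r ≠ 0 → ∃ m : ℤ, v (algebraMap F Ω r) = c ^ (N * m)) {z : Ω}
    (hz : v z = c ^ a) {f : F[X]} (hf : f.Monic) (hdeg : f.natDegree = N) (hfz : aeval z f = 0) :
    minpoly F z = f := by
  have hint : IsIntegral F z := ⟨f, hf, hfz⟩
  refine eq_of_monic_of_dvd_of_natDegree_le (minpoly.monic hint) hf (minpoly.dvd _ _ hfz) ?_ |>.symm
  by_contra! h
  obtain ⟨m, hm⟩ := exists_valuation_aeval_eq_zpow hc ha hF hz (minpoly.ne_zero hint)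
    (h.trans_eq hdeg)
  rw [minpoly.aeval, map_zero] at hm
  exact zpow_ne_zero m (zero_lt_one.trans hc).ne' hm.symm

/-- Every element is a polynomial in `z`, which can be reduced modulo `f` to degree below `N`. -/
theorem exists_valuation_eq_zpow_of_mem_adjoin {F Ω : Type*} [Field F] [Field Ω] [Algebra F Ω]
    {v : Valuation Ω Γ} {c : Γ} (hc : 1 < c) {N a : ℕ} (ha : a.Coprime N)
    (hF : ∀ r : F, r ≠ 0 → ∃ m : ℤ, v (algebraMap F Ω r) = c ^ (N * m)) {z : Ω}
    (hz : v z = c ^ a) {f : F[X]} (hf : f.Monic) (hdeg : f.natDegree = N) (hfz : aeval z f = 0)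
    {r : Ω} (hr : r ∈ F⟮z⟯) (hr0 : r ≠ 0) : ∃ m : ℤ, v r = c ^ m := by
  have hint : IsIntegral F z := ⟨f, hf, hfz⟩
  rw [← mem_toSubalgebra, adjoin_simple_toSubalgebra_of_isAlgebraic hint.isAlgebraic,
    Algebra.adjoin_singleton_eq_range_aeval] at hr
  obtain ⟨p, rfl⟩ := hr
  have h1 : aeval z (p %ₘ f) = aeval z p := aeval_modByMonic_eq_self_of_root hfz
  have hN : N ≠ 0 := by
    rintro rfl
    rw [hf.natDegree_eq_zero.1 hdeg] at hfz
    simp at hfz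
  change aeval z p ≠ 0 at hr0
  change ∃ m : ℤ, v (aeval z p) = c ^ m
  rw [← h1] at hr0 ⊢
  refine exists_valuation_aeval_eq_zpow hc ha hF hz (fun h ↦ hr0 (by rw [h, map_zero])) ?_
  rw [← hdeg]
  exact natDegree_modByMonic_lt _ hf fun h ↦ hN (by rw [← hdeg, h, natDegree_one])

theorem exists_valuation_eq_zpow_of_mem_adjoin_of_isTrivialOn {E Ω : Type*} [Field E] [Field Ω]
    [Algebra E Ω] {v : Valuation Ω Γ} [v.IsTrivialOn E] {x : Ω} (hx : 1 < v x) {r : Ω}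
    (hr : r ∈ E⟮x⟯) (hr0 : r ≠ 0) : ∃ m : ℤ, v r = v x ^ m := by
  have hx0 : v x ≠ 0 := (zero_lt_one.trans hx).ne'
  obtain ⟨s, t, rfl⟩ := (mem_adjoin_simple_iff E r).1 hr
  have hs : s ≠ 0 := by
    rintro rfl
    simp at hr0
  have ht : t ≠ 0 := by
    rintro rfl
    simp at hr0
  refine ⟨s.natDegree - t.natDegree, ?_⟩
  rw [map_div₀, valuation_aeval_eq_valuation_X_pow_natDegree_of_one_lt_valuation_X x hx hs,
    valuation_aeval_eq_valuation_X_pow_natDegree_of_one_lt_valuation_X x hx ht, zpow_sub₀ hx0,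
    zpow_natCast, zpow_natCast]

/-- A transcendental element has a pole at some valuation trivial on the base field. -/
theorem exists_valuationSubring_of_transcendental {E Ω : Type*} [Field E] [Field Ω] [Algebra E Ω]
    {x : Ω} (hx : Transcendental E x) :
    ∃ V : ValuationSubring Ω, V.valuation.IsTrivialOn E ∧ 1 < V.valuation x := by
  -- An integrally closed subring that misses `x` lies in a valuation ring that misses `x`.
  have h : x ∉ (integralClosure E Ω).toSubring := fun h ↦ hx (IsIntegral.isAlgebraic h)
  have : IsIntegrallyClosedIn (integralClosure E Ω).toSubring Ω :=
    inferInstanceAs (IsIntegrallyClosedIn (integralClosure E Ω) Ω)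
  obtain ⟨V, hV, hxV⟩ := Subring.exists_le_valuationSubring_of_isIntegrallyClosedIn h
  have hE (a : E) : V.valuation (algebraMap E Ω a) ≤ 1 :=
    (V.valuation_le_one_iff _).2 (hV (algebraMap_mem (integralClosure E Ω) a))
  refine ⟨V, ⟨fun a ha ↦ (hE a).antisymm ?_⟩, ?_⟩
  · have := hE a⁻¹
    rw [map_inv₀, map_inv₀] at this
    exact (inv_le_one₀ (by simpa [zero_lt_iff] using ha)).1 this
  · rw [← not_le, V.valuation_le_one_iff]
    exact hxV

/-- In `z ^ q + z = x ^ (q + 1)` the element `z = x y` has a pole and `z ^ q` dominates; cancelling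
`v x ^ q` leaves `v x = v y ^ q`. -/
theorem valuation_of_opU_eq {k : Type u} [Field k] [Fintype k] {Ω : Type w} [Field Ω] [Algebra k Ω]
    {v : Valuation Ω Γ} {x y : Ω} (hx : 1 < v x) (h : opU k x y = x) :
    1 < v y ∧ v x = v y ^ Fintype.card k := by
  have hx0 : x ≠ 0 := by
    rintro rfl
    simp at hx
  have hq : 1 < Fintype.card k := Fintype.one_lt_card
  rw [opU_eq_iff hx0] at h
  have h1 : 1 < v (x * y) := by
    by_contra! hz
    have h2 : v ((x * y) ^ Fintype.card k + x * y) ≤ 1 :=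
      v.map_add_le (by rw [map_pow]; exact pow_le_one₀ zero_le hz) hz
    rw [h, map_pow] at h2
    exact (one_lt_pow₀ hx (by lia)).not_ge h2
  have h2 : v ((x * y) ^ Fintype.card k + x * y) = v (x * y) ^ Fintype.card k := by
    rw [v.map_add_eq_of_lt_left, map_pow]
    rw [map_pow]
    exact lt_self_pow₀ h1 hq
  rw [h, map_pow, map_mul, mul_pow, pow_succ,
    mul_right_inj' (pow_ne_zero _ (zero_lt_one.trans hx).ne')] at h2
  refine ⟨?_, h2⟩
  by_contra! hy
  rw [h2] at hx
  exact hx.not_ge (pow_le_one₀ zero_le hy)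

end Ramification

/-! ### Irreducibility of the tower equations -/

section Tower

variable {k : Type u} [Field k] [Fintype k] {E : Type v} [Field E] {Ω : Type w} [Field Ω]
  [Algebra k Ω] [Algebra E Ω]

local notation "q" => Fintype.card k

/-- The field `E(x 0, …, x n)`. -/
def towerField (E : Type v) [Field E] {Ω : Type w} [Field Ω] [Algebra E Ω] (x : ℕ → Ω) (n : ℕ) :
    IntermediateField E Ω :=
  adjoin E (x '' Set.Iic n)

theorem mem_towerField (E : Type v) [Field E] {Ω : Type w} [Field Ω] [Algebra E Ω] (x : ℕ → Ω)
    {i n : ℕ} (h : i ≤ n) : x i ∈ towerField E x n :=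
  subset_adjoin E _ ⟨i, h, rfl⟩

theorem towerField_zero (E : Type v) [Field E] {Ω : Type w} [Field Ω] [Algebra E Ω] (x : ℕ → Ω) :
    towerField E x 0 = E⟮x 0⟯ := by
  rw [towerField, ← bot_eq_zero, Set.Iic_bot, Set.image_singleton]

theorem towerField_succ {E : Type v} [Field E] {Ω : Type w} [Field Ω] [Algebra E Ω] {x : ℕ → Ω}
    {n : ℕ} (hx : x n ≠ 0) :
    towerField E x (n + 1) = ((towerField E x n)⟮x n * x (n + 1)⟯).restrictScalars E := by
  apply le_antisymm
  · rw [towerField, adjoin_le_iff]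
    rintro _ ⟨i, hi, rfl⟩
    rw [SetLike.mem_coe, mem_restrictScalars]
    have hmem (i : ℕ) (hi : i ≤ n) : x i ∈ (towerField E x n)⟮x n * x (n + 1)⟯ :=
      IntermediateField.algebraMap_mem (towerField E x n)⟮x n * x (n + 1)⟯
        (⟨x i, mem_towerField E x hi⟩ : towerField E x n)
    obtain hi | rfl := Nat.le_succ_iff.1 hi
    · exact hmem i hi
    · have := div_mem (mem_adjoin_simple_self (towerField E x n) (x n * x (n + 1)))
        (hmem n le_rfl)
      rwa [mul_div_cancel_left₀ _ hx] at this
  · rw [towerField, adjoin_adjoin_left, adjoin_le_iff]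
    rintro _ (⟨i, hi, rfl⟩ | rfl)
    · exact mem_towerField E x (hi.trans n.le_succ)
    · exact mul_mem (mem_towerField E x n.le_succ) (mem_towerField E x le_rfl)

theorem monic_X_pow_add_X_sub_C {R : Type*} [CommRing R] {m : ℕ} (hm : 1 < m) (a : R) :
    (X ^ m + X - C a).Monic := by
  nontriviality R
  rw [add_sub_assoc]
  exact monic_X_pow_add ((degree_X_sub_C_le _).trans_lt (by exact_mod_cast hm))

theorem natDegree_X_pow_add_X_sub_C {R : Type*} [CommRing R] [Nontrivial R] {m : ℕ} (hm : 1 < m)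
    (a : R) : (X ^ m + X - C a).natDegree = m := by
  rw [add_sub_assoc, natDegree_add_eq_left_of_natDegree_lt, natDegree_X_pow]
  rwa [natDegree_X_pow, natDegree_X_sub_C]

variable {Γ : Type*} [LinearOrderedCommGroupWithZero Γ] {v : Valuation Ω Γ}

theorem IsGSSeq.one_lt_valuation {n : ℕ} {x : ℕ → Ω} (hx : IsGSSeq k n x) (hv : 1 < v (x 0))
    {j : ℕ} (hj : j ≤ n) : 1 < v (x j) := by
  induction j with
  | zero => exact hv
  | succ j ih => exact (valuation_of_opU_eq (ih (by lia)) (hx.2 j hj)).1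

/-- Total ramification at the pole of `x 0`. -/
theorem IsGSSeq.tower_step {n : ℕ} {x : ℕ → Ω} (hx : IsGSSeq k n x) [v.IsTrivialOn E]
    (hv : 1 < v (x 0)) {j : ℕ} (hj : j ≤ n) :
    (∀ r ∈ towerField E x j, r ≠ 0 → ∃ m : ℤ, v r = v (x j) ^ m) ∧
    (j < n → minpoly (towerField E x j) (x j * x (j + 1)) =
      X ^ q + X - C ⟨x j ^ (q + 1), pow_mem (mem_towerField E x le_rfl) _⟩) := by
  have hq : 1 < q := Fintype.one_lt_card
  have hcop : (q + 1).Coprime q := by simp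
  -- With `c = v (x (i + 1))`, the lower field has values in powers of `c ^ q` and `z` has value `c
  -- ^ (q + 1)`: ramification of index `q`.
  have aux (i : ℕ) (hi : i < n)
      (h : ∀ r ∈ towerField E x i, r ≠ 0 → ∃ m : ℤ, v r = v (x i) ^ m) :
      1 < v (x (i + 1)) ∧
      (∀ r : towerField E x i, r ≠ 0 →
        ∃ m : ℤ, v (algebraMap (towerField E x i) Ω r) = v (x (i + 1)) ^ (q * m)) ∧
      v (x i * x (i + 1)) = v (x (i + 1)) ^ (q + 1) ∧
      aeval (x i * x (i + 1)) (X ^ q + X -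
        C (⟨x i ^ (q + 1), pow_mem (mem_towerField E x le_rfl) _⟩ : towerField E x i)) = 0 := by
    have h1 := valuation_of_opU_eq (hx.one_lt_valuation hv hi.le) (hx.2 i hi)
    refine ⟨h1.1, fun r hr ↦ ?_, ?_, ?_⟩
    · obtain ⟨m, hm⟩ := h r r.2 (by simpa using hr)
      refine ⟨m, ?_⟩
      rw [zpow_mul, zpow_natCast, ← h1.2]
      exact hm
    · rw [map_mul, h1.2, pow_succ]
    · have := (opU_eq_iff (hx.ne_zero hi.le)).1 (hx.2 i hi)
      simp only [map_sub, map_add, map_pow, aeval_X, aeval_C]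
      rw [this]
      exact sub_self _
  have h1 (j : ℕ) (hj : j ≤ n) :
      ∀ r ∈ towerField E x j, r ≠ 0 → ∃ m : ℤ, v r = v (x j) ^ m := by
    induction j with
    | zero =>
      rw [towerField_zero]
      exact fun r hr hr0 ↦ exists_valuation_eq_zpow_of_mem_adjoin_of_isTrivialOn hv hr hr0
    | succ j ih =>
      obtain ⟨a1, a2, a3, a4⟩ := aux j hj (ih (by lia))
      intro r hr hr0
      rw [towerField_succ (hx.ne_zero (by lia)), mem_restrictScalars] at hr
      exact exists_valuation_eq_zpow_of_mem_adjoin a1 hcop a2 a3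
        (monic_X_pow_add_X_sub_C hq _) (natDegree_X_pow_add_X_sub_C hq _) a4 hr hr0
  refine ⟨h1 j hj, fun hj' ↦ ?_⟩
  obtain ⟨a1, a2, a3, a4⟩ := aux j hj' (h1 j hj)
  exact minpoly_eq_of_valuation a1 hcop a2 a3
    (monic_X_pow_add_X_sub_C hq _) (natDegree_X_pow_add_X_sub_C hq _) a4

theorem IsGSSeq.minpoly_eq {n : ℕ} {x : ℕ → Ω} (hx : IsGSSeq k n x) (ht : Transcendental E (x 0))
    {j : ℕ} (hj : j < n) : minpoly (towerField E x j) (x j * x (j + 1)) =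
      X ^ q + X - C ⟨x j ^ (q + 1), pow_mem (mem_towerField E x le_rfl) _⟩ := by
  obtain ⟨V, hV, hxV⟩ := exists_valuationSubring_of_transcendental ht
  exact (hx.tower_step hxV hj.le).2 hj

theorem IsGSSeq.map_minpoly_eq {n : ℕ} {x : ℕ → Ω} (hx : IsGSSeq k n x)
    (ht : Transcendental E (x 0)) {j : ℕ} (hj : j < n) :
    (minpoly (towerField E x j) (x j * x (j + 1))).map (algebraMap (towerField E x j) Ω) =
      X ^ q + X - C (x j ^ (q + 1)) := by
  rw [hx.minpoly_eq ht hj]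
  simp

/-- In the other direction, the equation of `x 0` over `E(z)` is irreducible. -/
theorem IsGSSeq.minpoly_zero_eq {x : ℕ → Ω} (hx : IsGSSeq k 1 x) (ht : Transcendental E (x 0)) :
    Transcendental E (x 0 * x 1) ∧ (minpoly E⟮x 0 * x 1⟯ (x 0)).natDegree = q + 1 := by
  obtain ⟨V, hV, hxV⟩ := exists_valuationSubring_of_transcendental ht
  have hq : 1 < q := Fintype.one_lt_card
  have h1 := valuation_of_opU_eq hxV (hx.2 0 zero_lt_one)
  rw [zero_add] at h1
  have hz : V.valuation (x 0 * x 1) = V.valuation (x 1) ^ (q + 1) := by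
    rw [map_mul, h1.2, pow_succ]
  have hz1 : 1 < V.valuation (x 0 * x 1) := hz ▸ one_lt_pow₀ h1.1 (by lia)
  refine ⟨Valuation.transcendental_of_ne_one E _ ?_ hz1.ne', ?_⟩
  · exact mul_ne_zero (hx.ne_zero zero_le_one) (hx.ne_zero le_rfl)
  let z : E⟮x 0 * x 1⟯ := ⟨x 0 * x 1, mem_adjoin_simple_self E _⟩
  have h2 : minpoly E⟮x 0 * x 1⟯ (x 0) = X ^ (q + 1) - C (z ^ q + z) := by
    -- Relative to `c = v (x 1)`, `E(z)` has values in powers of `c ^ (q + 1)`, while `x 0` has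
    -- value `c ^ q`.
    refine minpoly_eq_of_valuation (N := q + 1) (a := q) h1.1 (by simp) (fun r hr ↦ ?_) h1.2
      (monic_X_pow_sub_C _ (by lia)) (natDegree_X_pow_sub_C) ?_
    · obtain ⟨m, hm⟩ := exists_valuation_eq_zpow_of_mem_adjoin_of_isTrivialOn hz1 r.2
        (by simpa using hr)
      refine ⟨m, ?_⟩
      rw [zpow_mul, zpow_natCast, ← hz]
      exact hm
    · have := (opU_eq_iff (hx.ne_zero zero_le_one)).1 (hx.2 0 zero_lt_one)
      rw [map_sub, map_pow, aeval_X, aeval_C, ← this]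
      exact sub_self _
  rw [h2, natDegree_X_pow_sub_C]

end Tower

/-! ### Rational function fields inside `Ω` -/

section RationalFunctions

variable {E : Type v} [Field E]

theorem ratFunc_algHom_ext {F : Type*} [Field F] [Algebra E F] {a b : RatFunc E →ₐ[E] F}
    (h : a RatFunc.X = b RatFunc.X) : a = b := by
  have h1 (p : E[X]) : a (algebraMap E[X] (RatFunc E) p) = b (algebraMap E[X] (RatFunc E) p) := by
    have : (a.comp (IsScalarTower.toAlgHom E E[X] (RatFunc E))) =
        (b.comp (IsScalarTower.toAlgHom E E[X] (RatFunc E))) := by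
      ext
      simpa using h
    exact DFunLike.congr_fun this p
  ext r
  rw [← RatFunc.num_div_denom r, map_div₀, map_div₀, h1, h1]

theorem exists_ratFunc_algHom {F : Type*} [Field F] [Algebra E F] {y : F}
    (hy : Transcendental E y) : ∃ a : RatFunc E →ₐ[E] F, a RatFunc.X = y :=
  ⟨E⟮y⟯.val.comp (RatFunc.algEquivOfTranscendental y hy).toAlgHom, by simp⟩

variable {Ω : Type w} [Field Ω] [Algebra E Ω] [Algebra (RatFunc E) Ω]
  [IsScalarTower E (RatFunc E) Ω]

theorem transcendental_algebraMap_X : Transcendental E (algebraMap (RatFunc E) Ω RatFunc.X) :=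
  (transcendental_algebraMap_iff (algebraMap (RatFunc E) Ω).injective).2 RatFunc.transcendental_X

theorem algebraMap_ratFunc_mem {F : IntermediateField E Ω}
    (h : algebraMap (RatFunc E) Ω RatFunc.X ∈ F) (r : RatFunc E) :
    algebraMap (RatFunc E) Ω r ∈ F := by
  have h1 (p : E[X]) : algebraMap (RatFunc E) Ω (algebraMap E[X] (RatFunc E) p) ∈ F := by
    induction p using Polynomial.induction_on' with
    | add p s hp hs => simpa using add_mem hp hs
    | monomial n c =>
      rw [← C_mul_X_pow_eq_monomial, map_mul, map_pow, RatFunc.algebraMap_X, RatFunc.algebraMap_C,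
        map_mul, map_pow, ← RatFunc.algebraMap_eq_C, ← IsScalarTower.algebraMap_apply]
      exact mul_mem (F.algebraMap_mem c) (pow_mem h n)
  rw [← RatFunc.num_div_denom r, map_div₀]
  exact div_mem (h1 _) (h1 _)

theorem restrictScalars_adjoin_ratFunc {S : Set Ω}
    (h : algebraMap (RatFunc E) Ω RatFunc.X ∈ adjoin E S) :
    (adjoin (RatFunc E) S).restrictScalars E = adjoin E S := by
  apply le_antisymm
  · intro y hy
    rw [mem_restrictScalars] at hy
    induction hy using adjoin_induction with
    | mem y hy => exact subset_adjoin E S hy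
    | algebraMap r => exact algebraMap_ratFunc_mem h r
    | add y z _ _ hy hz => exact add_mem hy hz
    | inv y _ hy => exact inv_mem hy
    | mul y z _ _ hy hz => exact mul_mem hy hz
  · rw [adjoin_le_iff]
    exact subset_adjoin (RatFunc E) S

end RationalFunctions

theorem map_gCoeff {k : Type u} [Fintype k] {F F' : Type*} [Field F] [Field F']
    (f : F →+* F') (x : F) : f (gCoeff k x) = gCoeff k (f x) := by
  simp [gCoeff]

theorem gCoeff_mem {k : Type u} [Fintype k] {E : Type v} [Field E] {Ω : Type w} [Field Ω]
    [Algebra E Ω] {F : IntermediateField E Ω} {x : Ω} (hx : x ∈ F) :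
    gCoeff k x ∈ F :=
  mul_mem (inv_mem (pow_mem hx _)) (sub_mem (pow_mem hx _) hx)

/-! ### Galois action on the generic level structures -/

section Generic

variable {k : Type u} [Fintype k] {E : Type v} [Field E] {Ω : Type w} [Field Ω]
  [Algebra E Ω] [Algebra (RatFunc E) Ω]

theorem algebraMap_X_mem_towerField {x : ℕ → Ω} {n : ℕ}
    (hg : algebraMap (RatFunc E) Ω RatFunc.X = gCoeff k (x 0)) :
    algebraMap (RatFunc E) Ω RatFunc.X ∈ towerField E x n := by
  rw [hg]
  exact gCoeff_mem (mem_towerField E x n.zero_le)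

variable [IsScalarTower E (RatFunc E) Ω]

theorem transcendental_of_gCoeff_eq {x : Ω}
    (hx : algebraMap (RatFunc E) Ω RatFunc.X = gCoeff k x) : Transcendental E x := by
  intro h
  have h1 : Algebra.IsAlgebraic E E⟮x⟯ := isAlgebraic_adjoin_simple h.isIntegral
  have h2 := h1.isAlgebraic ⟨gCoeff k x, gCoeff_mem (mem_adjoin_simple_self E x)⟩
  refine transcendental_algebraMap_X (E := E) (Ω := Ω) ?_
  rw [hx]
  exact h2.algebraMap (A := Ω)

/-- Any two nonzero zeros of the generic `φ_T` are conjugate. -/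
theorem exists_algEquiv_of_gCoeff_eq [Normal (RatFunc E) Ω] {x x' : Ω}
    (hx : algebraMap (RatFunc E) Ω RatFunc.X = gCoeff k x)
    (hx' : algebraMap (RatFunc E) Ω RatFunc.X = gCoeff k x') :
    ∃ σ : Ω ≃ₐ[RatFunc E] Ω, σ x = x' := by
  obtain ⟨a, ha⟩ := exists_ratFunc_algHom (transcendental_of_gCoeff_eq hx)
  obtain ⟨a', ha'⟩ := exists_ratFunc_algHom (transcendental_of_gCoeff_eq hx')
  have hag : a (gCoeff k RatFunc.X) = algebraMap (RatFunc E) Ω RatFunc.X := by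
    rw [hx, ← ha]
    exact map_gCoeff (a : RatFunc E →+* Ω) _
  have hag' : a' (gCoeff k RatFunc.X) = algebraMap (RatFunc E) Ω RatFunc.X := by
    rw [hx', ← ha']
    exact map_gCoeff (a' : RatFunc E →+* Ω) _
  have hg : Transcendental E (gCoeff k (RatFunc.X : RatFunc E)) := fun h ↦
    transcendental_algebraMap_X (E := E) (Ω := Ω) (hag ▸ h.algHom a)
  -- `c` substitutes `gCoeff k X` for the variable; following it by `X ↦ x` or by `X ↦ x'` gives the
  -- structure map.
  obtain ⟨c, hc⟩ := exists_ratFunc_algHom hg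
  have hj : a.comp c = IsScalarTower.toAlgHom E (RatFunc E) Ω :=
    ratFunc_algHom_ext (by simp [hc, hag])
  have hj' : a'.comp c = IsScalarTower.toAlgHom E (RatFunc E) Ω :=
    ratFunc_algHom_ext (by simp [hc, hag'])
  have hint : IsIntegral (RatFunc E) x := Algebra.IsIntegral.isIntegral x
  -- Both values of the minimal polynomial are images of a single rational function. It vanishes
  -- under the injective `a`, so it is zero, and `x'` is a root too.
  have key (b : RatFunc E →ₐ[E] Ω) (hb : b.comp c = IsScalarTower.toAlgHom E (RatFunc E) Ω) :
      aeval (b RatFunc.X) (minpoly (RatFunc E) x) =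
        b (eval₂ (c : RatFunc E →+* RatFunc E) RatFunc.X (minpoly (RatFunc E) x)) := by
    have hb' : (b : RatFunc E →+* Ω).comp (c : RatFunc E →+* RatFunc E) =
        algebraMap (RatFunc E) Ω := congrArg (fun f : RatFunc E →ₐ[E] Ω ↦ (f : RatFunc E →+* Ω)) hb
    rw [aeval_def, ← hb']
    exact (hom_eval₂ _ _ (b : RatFunc E →+* Ω) _).symm
  have h1 := key a hj
  rw [ha, minpoly.aeval, eq_comm, map_eq_zero] at h1
  have h2 := key a' hj'
  rw [ha', h1, map_zero] at h2
  obtain ⟨σ, hσ⟩ := (Normal.minpoly_eq_iff_mem_orbit Ω).1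
    (minpoly.eq_of_irreducible_of_monic (minpoly.irreducible hint) h2 (minpoly.monic hint))
  exact ⟨σ.symm, σ.symm_apply_eq.2 hσ.symm⟩

variable [Field k] [Algebra k Ω]

/-- After `σ` matches the first coordinates, irreducibility over the field they generate supplies an
automorphism fixing them and matching the next one. -/
theorem IsGSSeq.exists_algEquiv [Normal (RatFunc E) Ω] {x x' : ℕ → Ω} {n : ℕ}
    (hx : IsGSSeq k n x) (hx' : IsGSSeq k n x')
    (hg : algebraMap (RatFunc E) Ω RatFunc.X = gCoeff k (x 0))
    (hg' : algebraMap (RatFunc E) Ω RatFunc.X = gCoeff k (x' 0)) {j : ℕ} (hj : j ≤ n) :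
    ∃ σ : Ω ≃ₐ[RatFunc E] Ω, ∀ i ≤ j, σ (x i) = x' i := by
  induction j with
  | zero =>
    obtain ⟨σ, hσ⟩ := exists_algEquiv_of_gCoeff_eq hg hg'
    exact ⟨σ, fun i hi ↦ by rwa [Nat.le_zero.1 hi]⟩
  | succ j ih =>
    obtain ⟨σ, hσ⟩ := ih (by lia)
    let F := adjoin (RatFunc E) (x' '' Set.Iic j)
    have hmem (i : ℕ) (hi : i ≤ j) : x' i ∈ F := subset_adjoin _ _ ⟨i, hi, rfl⟩
    -- `F` contains `E(g)` by construction, and `g` lies in `E(x' 0)`, so the irreducibility result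
    -- over the tower field applies to `F`.
    have hF : F.restrictScalars E = towerField E x' j :=
      restrictScalars_adjoin_ratFunc (algebraMap_X_mem_towerField hg')
    have hmin := hx'.map_minpoly_eq (transcendental_of_gCoeff_eq hg') hj
    rw [← hF] at hmin
    change (minpoly F (x' j * x' (j + 1))).map (algebraMap F Ω) = _ at hmin
    have h1 : aeval (x' j * σ (x (j + 1))) (minpoly F (x' j * x' (j + 1))) = 0 := by
      have h2 := (hx.map σ).2 j hj
      rw [opU_eq_iff ((hx.map σ).ne_zero (by lia)), Function.comp_apply, hσ j le_rfl,
        Function.comp_apply] at h2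
      rw [← eval_map_algebraMap, hmin]
      simp [h2]
    have hint : IsIntegral F (x' j * x' (j + 1)) :=
      (Algebra.IsIntegral.isIntegral (R := RatFunc E) _).tower_top
    have : Normal F Ω := Normal.tower_top_of_normal (RatFunc E) F Ω
    obtain ⟨τ, hτ⟩ := (Normal.minpoly_eq_iff_mem_orbit Ω).1
      (minpoly.eq_of_irreducible_of_monic (minpoly.irreducible hint) h1 (minpoly.monic hint))
    have hτF (i : ℕ) (hi : i ≤ j) : τ (x' i) = x' i := τ.commutes ⟨x' i, hmem i hi⟩
    refine ⟨σ.trans (τ.restrictScalars (RatFunc E)), fun i hi ↦ ?_⟩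
    change τ (σ (x i)) = x' i
    obtain hi | rfl := Nat.le_succ_iff.1 hi
    · rw [hσ i hi, hτF i hi]
    · refine mul_left_cancel₀ (hx'.ne_zero (j := j) (by lia)) ?_
      rw [← hτF j le_rfl, ← map_mul, hτF j le_rfl]
      exact hτ

/-- The field fixed by the stabilizer of a level structure is generated by the coordinates. -/
theorem IsGSSeq.levelField_eq [IsSepClosed Ω] [IsGalois (RatFunc E) Ω] {x : ℕ → Ω} {n : ℕ}
    (hx : IsGSSeq k n x) (hg : algebraMap (RatFunc E) Ω RatFunc.X = gCoeff k (x 0)) :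
    (levelField (RatFunc E) (x 0) (seqZeros k x n)).restrictScalars E = towerField E x n := by
  have h1 : levelField (RatFunc E) (x 0) (seqZeros k x n) =
      adjoin (RatFunc E) (x '' Set.Iic n) := by
    -- By the Galois correspondence it remains to see that stabilizing `(x 0, G)` means fixing every
    -- coordinate.
    rw [levelField, ← InfiniteGalois.fixedField_fixingSubgroup (adjoin _ _)]
    congr 1
    ext σ
    rw [Subgroup.mem_inf, MulAction.mem_stabilizer_iff, MulAction.mem_stabilizer_iff,
      AlgEquiv.smul_def]
    change _ ∧ σ '' _ = _ ↔ _
    rw [image_seqZeros, IntermediateField.mem_fixingSubgroup_iff]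
    constructor
    · rintro ⟨h0, hG⟩ y hy
      induction hy using adjoin_induction with
      | mem y hy =>
        obtain ⟨i, hi, rfl⟩ := hy
        exact (hx.map σ).eq_of_seqZeros_eq hx h0 hG hi
      | algebraMap r => exact σ.commutes r
      | add y z _ _ hy hz => rw [map_add, hy, hz]
      | inv y _ hy => rw [map_inv₀, hy]
      | mul y z _ _ hy hz => rw [map_mul, hy, hz]
    · intro h
      have hfix (i : ℕ) (hi : i ≤ n) : σ (x i) = x i :=
        h (x i) (subset_adjoin _ _ ⟨i, hi, rfl⟩)
      refine ⟨hfix 0 n.zero_le, ?_⟩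
      exact seqZeros_congr hfix
  rw [h1]
  exact restrictScalars_adjoin_ratFunc (algebraMap_X_mem_towerField hg)

end Generic

/-! ### Existence of torsion points and infinite sequences -/

section Existence

variable {k : Type u} [Field k] [Fintype k] {Ω : Type w} [Field Ω] [Algebra k Ω] [IsSepClosed Ω]

local notation "q" => Fintype.card k

/-- `Y ^ (q ^ 2) - g Y ^ q - Y` has derivative `-1`, hence is separable; dividing by `Y` discards
the root zero. -/
theorem exists_eq_gCoeff (g : Ω) : ∃ x : Ω, x ≠ 0 ∧ g = gCoeff k x := by
  have hq1 : 1 < q := Fintype.one_lt_card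
  have hq : (q : Ω) = 0 := by
    rw [← map_natCast (algebraMap k Ω), Nat.cast_card_eq_zero, map_zero]
  have hq2 : q < q ^ 2 := lt_self_pow₀ hq1 one_lt_two
  have hsep : (X ^ (q ^ 2) - C g * X ^ q - X : Polynomial Ω).Separable := by
    refine ⟨0, -1, ?_⟩
    simp [derivative_X_pow, hq]
  have hmul : (X ^ (q ^ 2 - 1) - C g * X ^ (q - 1) - 1) * X =
      (X ^ (q ^ 2) - C g * X ^ q - X : Polynomial Ω) := by
    rw [sub_mul, sub_mul, mul_assoc, pow_sub_one_mul (by lia), pow_sub_one_mul (by lia), one_mul]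
  have hdeg : (X ^ (q ^ 2 - 1) - C g * X ^ (q - 1) - 1 : Polynomial Ω).natDegree = q ^ 2 - 1 := by
    rw [← C_1, natDegree_sub_C, natDegree_sub_eq_left_of_natDegree_lt, natDegree_X_pow]
    rw [natDegree_X_pow]
    exact (natDegree_C_mul_X_pow_le _ _).trans_lt (by lia)
  obtain ⟨x, hx⟩ := IsSepClosed.exists_root (X ^ (q ^ 2 - 1) - C g * X ^ (q - 1) - 1 : Polynomial Ω)
    (degree_ne_of_natDegree_ne (n := 0) (by lia)) (hsep.of_dvd ⟨X, hmul.symm⟩)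
  have hx0 : x ≠ 0 := by
    rintro rfl
    simp [zero_pow (show q ^ 2 - 1 ≠ 0 by lia), zero_pow (show q - 1 ≠ 0 by lia)] at hx
  refine ⟨x, hx0, (opN_eq_zero_iff hx0).1 ?_⟩
  have h1 := congrArg (eval x) hmul
  rw [eval_mul, hx.eq_zero, zero_mul] at h1
  simp only [eval_sub, eval_pow, eval_X, eval_mul, eval_C] at h1
  rw [opN_apply]
  linear_combination h1

theorem exists_isGSSeq {x₁ : Ω} (h : x₁ ≠ 0) : ∃ x : ℕ → Ω, x 0 = x₁ ∧ ∀ n, IsGSSeq k n x := by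
  choose f hf using fun x : {x : Ω // x ≠ 0} ↦ opU_surjective (k := k) x.2 (x : Ω)
  let s : ℕ → {x : Ω // x ≠ 0} := fun n ↦
    Nat.rec ⟨x₁, h⟩ (fun _ x ↦ ⟨f x, ne_zero_of_opU_eq x.2 (hf x)⟩) n
  let x : ℕ → Ω := fun n ↦ (s n).1
  have hx (j : ℕ) : opU k (x j) (x (j + 1)) = x j := hf (s j)
  exact ⟨x, rfl, fun n ↦ ⟨h, fun j _ ↦ hx j⟩⟩

end Existence

/-! ### Function fields of plane curves -/

section PlaneCurve

variable {E : Type v} [Field E] {Ω : Type w} [Field Ω] [Algebra E Ω]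

/-- The substitution of the variables `X i`, `X j` in a polynomial in `E[X][Y]`. -/
noncomputable def bivariateToMv (E : Type v) [Field E] (i j : Fin 2) :
    E[X][X] →+* MvPolynomial (Fin 2) E :=
  eval₂RingHom (aeval (MvPolynomial.X i : MvPolynomial (Fin 2) E)).toRingHom (MvPolynomial.X j)

@[simp]
theorem bivariateToMv_C (i j : Fin 2) (p : E[X]) :
    bivariateToMv E i j (C p) = aeval (MvPolynomial.X i) p :=
  eval₂_C _ _

@[simp]
theorem bivariateToMv_X (i j : Fin 2) : bivariateToMv E i j X = MvPolynomial.X j :=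
  eval₂_X _ _

theorem bivariateToMv_surjective {i j : Fin 2} (hij : ∀ l, l = i ∨ l = j) :
    Function.Surjective (bivariateToMv E i j) := by
  intro p
  induction p using MvPolynomial.induction_on with
  | C a => exact ⟨C (C a), by simp [MvPolynomial.algebraMap_eq]⟩
  | add p s hp hs =>
    obtain ⟨P, rfl⟩ := hp
    obtain ⟨S, rfl⟩ := hs
    exact ⟨P + S, map_add _ _ _⟩
  | mul_X p l hp =>
    obtain ⟨P, rfl⟩ := hp
    obtain rfl | rfl := hij l
    · exact ⟨P * C X, by simp⟩
    · exact ⟨P * X, by simp⟩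

theorem aeval_bivariateToMv (c : Fin 2 → Ω) (i j : Fin 2) (P : E[X][X]) :
    MvPolynomial.aeval c (bivariateToMv E i j P) =
      aeval (c j) (P.map (aeval (AdjoinSimple.gen E (c i))).toRingHom) := by
  have h : ((MvPolynomial.aeval c).comp (aeval (MvPolynomial.X i : MvPolynomial (Fin 2) E))) =
      (E⟮c i⟯.val.comp (aeval (AdjoinSimple.gen E (c i)))) := by
    ext
    simp
  rw [aeval_def, eval₂_map, bivariateToMv, coe_eval₂RingHom]
  have h1 := hom_eval₂ P (aeval (MvPolynomial.X i : MvPolynomial (Fin 2) E)).toRingHom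
    (MvPolynomial.aeval c).toRingHom (MvPolynomial.X j)
  refine h1.trans ?_
  congr 1
  · exact congrArg (fun f : E[X] →ₐ[E] Ω ↦ (f : E[X] →+* Ω)) h
  · exact MvPolynomial.aeval_X c j

/-- The ideal of a point of a plane curve whose equation is monic in one coordinate, of the degree
of this coordinate of the point over the field generated by the other coordinate. -/
theorem ker_aeval_eq_span {c : Fin 2 → Ω} {i j : Fin 2} (hij : ∀ l, l = i ∨ l = j)
    (hi : Transcendental E (c i)) {P : E[X][X]} (hP : P.Monic)
    (hdeg : (minpoly E⟮c i⟯ (c j)).degree = P.degree)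
    (hc : MvPolynomial.aeval c (bivariateToMv E i j P) = 0) :
    RingHom.ker (MvPolynomial.aeval (R := E) c) = Ideal.span {bivariateToMv E i j P} := by
  apply le_antisymm
  · intro p hp
    rw [RingHom.mem_ker] at hp
    obtain ⟨S, rfl⟩ := bivariateToMv_surjective hij p
    rw [Ideal.mem_span_singleton]
    suffices h : S %ₘ P = 0 by
      exact map_dvd _ ((modByMonic_eq_zero_iff_dvd hP).1 h)
    rw [← modByMonic_add_div S P, map_add, map_add, map_mul, map_mul, hc, zero_mul, add_zero,
      aeval_bivariateToMv] at hp
    have hinj : Function.Injective (aeval (R := E) (AdjoinSimple.gen E (c i))).toRingHom := by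
      have : Transcendental E (AdjoinSimple.gen E (c i)) := fun h ↦
        hi (h.algebraMap (A := Ω))
      exact transcendental_iff_injective.1 this
    -- A nonzero remainder would give a polynomial over `E(c i)` killing `c j`, of degree below that
    -- of its minimal polynomial.
    by_contra hne
    have h1 := minpoly.degree_le_of_ne_zero E⟮c i⟯ (c j)
      ((Polynomial.map_ne_zero_iff hinj).2 hne) hp
    rw [hdeg, degree_map_eq_of_injective hinj] at h1
    exact h1.not_gt (degree_modByMonic_lt S hP)
  · rw [Ideal.span_singleton_le_iff_mem]
    exact hc

open algebraAdjoinAdjoin in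
-- The coordinate ring is `E[c]` inside the field `Ω`, hence a domain, with fraction field `E(c)`.
theorem exists_planeCurveField_algEquiv {c : Fin 2 → Ω} {f : MvPolynomial (Fin 2) E}
    (h : RingHom.ker (MvPolynomial.aeval (R := E) c) = Ideal.span {f})
    {F : IntermediateField E Ω} (hF : adjoin E (Set.range c) = F) :
    ∃ e : PlaneCurveField f ≃ₐ[E] F,
      ∀ p, (e (PlaneCurveField.ofPoly f p) : Ω) = MvPolynomial.aeval c p := by
  subst hF
  let e₀ : (MvPolynomial (Fin 2) E ⧸ Ideal.span {f}) ≃ₐ[E] Algebra.adjoin E (Set.range c) :=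
    ((Ideal.quotientEquivAlgOfEq E h.symm).trans
      (Ideal.quotientKerEquivRange (MvPolynomial.aeval (R := E) c))).trans
      (Subalgebra.equivOfEq _ _ (Algebra.adjoin_range_eq_range_aeval E c).symm)
  have : IsDomain (MvPolynomial (Fin 2) E ⧸ Ideal.span {f}) := MulEquiv.isDomain _ e₀.toMulEquiv
  refine ⟨IsFractionRing.algEquivOfAlgEquiv (R := E) e₀, fun p ↦ ?_⟩
  rw [PlaneCurveField.ofPoly, IsFractionRing.algEquivOfAlgEquiv_algebraMap]
  rfl

end PlaneCurve

/-! ### The Hermitian and Fermat curves -/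

section HermitianCurve

variable {k : Type u} [Field k] [Fintype k] {E : Type v} [Field E] {Ω : Type w} [Field Ω]
  [Algebra k Ω] [Algebra E Ω]

local notation "q" => Fintype.card k

theorem towerField_one {x : ℕ → Ω} (hx : x 0 ≠ 0) :
    towerField E x 1 = adjoin E {x 0, x 0 * x 1} := by
  apply le_antisymm
  · have h0 : x 0 ∈ adjoin E {x 0, x 0 * x 1} := subset_adjoin E _ (by simp)
    have h1 : x 0 * x 1 ∈ adjoin E {x 0, x 0 * x 1} := subset_adjoin E _ (by simp)
    rw [towerField, adjoin_le_iff]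
    rintro _ ⟨i, hi, rfl⟩
    obtain rfl | rfl : i = 0 ∨ i = 1 := by
      have : i ≤ 1 := hi
      lia
    · exact h0
    · have := div_mem h1 h0
      rwa [mul_div_cancel_left₀ _ hx] at this
  · rw [adjoin_le_iff]
    have h0 := mem_towerField E x zero_le_one
    have h1 := mem_towerField E x le_rfl (i := 1)
    rintro _ (rfl | rfl)
    · exact h0
    · exact mul_mem h0 h1

theorem IsGSSeq.exists_hermitian_algEquiv {x : ℕ → Ω} (hx : IsGSSeq k 1 x)
    (ht : Transcendental E (x 0)) :
    ∃ e : PlaneCurveField (hermitianPoly q E) ≃ₐ[E] towerField E x 1,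
      (e (PlaneCurveField.ofPoly _ (MvPolynomial.X 0)) : Ω) = x 0 ∧
      (e (PlaneCurveField.ofPoly _ (MvPolynomial.X 1)) : Ω) = x 0 * x 1 := by
  have hq : 1 < q := Fintype.one_lt_card
  let c : Fin 2 → Ω := ![x 0, x 0 * x 1]
  let P : E[X][X] := X ^ q + X - C (X ^ (q + 1))
  have hP : bivariateToMv E 0 1 P = hermitianPoly q E := by
    simp [P, hermitianPoly]
  have hrel := (opU_eq_iff (hx.ne_zero zero_le_one)).1 (hx.2 0 zero_lt_one)
  have hdeg : (minpoly E⟮x 0⟯ (x 0 * x 1)).degree = P.degree := by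
    have h1 := hx.minpoly_eq ht zero_lt_one
    have h2 : (minpoly (towerField E x 0) (x 0 * x 1)).natDegree = q := by
      rw [h1, natDegree_X_pow_add_X_sub_C hq]
    have h3 : (minpoly (towerField E x 0) (x 0 * x 1)) ≠ 0 := by
      rw [h1]
      exact (monic_X_pow_add_X_sub_C hq _).ne_zero
    have h4 := (degree_eq_natDegree h3).trans (congrArg _ h2)
    rw [towerField_zero] at h4
    rw [h4, degree_eq_natDegree (monic_X_pow_add_X_sub_C hq _).ne_zero,
      natDegree_X_pow_add_X_sub_C hq]
  have hker := ker_aeval_eq_span (c := c) (i := 0) (j := 1) (by decide) ht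
    (monic_X_pow_add_X_sub_C hq _) hdeg (by
      rw [hP]
      simp [hermitianPoly, c, ← hrel])
  rw [hP] at hker
  obtain ⟨e, he⟩ := exists_planeCurveField_algEquiv hker (F := towerField E x 1) (by
    rw [towerField_one (hx.ne_zero zero_le_one)]
    simp [c, Set.pair_comm])
  exact ⟨e, (he _).trans (by simp [c]), (he _).trans (by simp [c])⟩

/-- The left side is the trace of the quadratic extension, which is surjective. -/
theorem exists_pow_card_add_self_eq_neg_one [Algebra k E] (h : Module.finrank k E = 2) :
    ∃ β : E, β ^ q + β = -1 := by
  have : FiniteDimensional k E := Module.finite_of_finrank_eq_succ h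
  have : Finite E := Module.finite_of_finite k
  obtain ⟨β, hβ⟩ := Algebra.trace_surjective k E (-1)
  refine ⟨β, ?_⟩
  have h1 := FiniteField.algebraMap_trace_eq_sum_pow k E β
  rw [hβ, h] at h1
  simp [Finset.sum_range_succ] at h1
  linear_combination -h1

theorem minpoly_natDegree_div {F : IntermediateField E Ω} {x a : Ω} (ha : a ∈ F) (ha0 : a ≠ 0)
    (hx : IsIntegral F x) : (minpoly F (x / a)).natDegree = (minpoly F x).natDegree := by
  let a' : F := ⟨a, ha⟩
  have hxa : IsIntegral F (x / a) := by
    rw [div_eq_mul_inv]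
    exact hx.mul (isIntegral_algebraMap (x := a'⁻¹))
  have h1 : a ∈ F⟮x⟯ := F⟮x⟯.algebraMap_mem a'
  have h2 : a ∈ F⟮x / a⟯ := F⟮x / a⟯.algebraMap_mem a'
  have h : F⟮x / a⟯ = F⟮x⟯ := by
    apply le_antisymm
    · rw [adjoin_simple_le_iff]
      exact div_mem (mem_adjoin_simple_self F x) h1
    · rw [adjoin_simple_le_iff]
      have := mul_mem (mem_adjoin_simple_self F (x / a)) h2
      rwa [div_mul_cancel₀ _ ha0] at this
  rw [← adjoin.finrank hxa, ← adjoin.finrank hx, h]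

/-- For `m = z + b`, `(m + 1) ^ (q + 1) - m ^ (q + 1) = m ^ q + m + 1 = z ^ q + z`, by the choice of
`b`. -/
theorem div_pow_add_div_pow_eq_one {x z b : Ω} (h : z ^ q + z = x ^ (q + 1))
    (hb : b ^ q + b = -1) (hm : z + b + 1 ≠ 0) :
    (x / (z + b + 1)) ^ (q + 1) + ((z + b) / (z + b + 1)) ^ (q + 1) = 1 := by
  rw [div_pow, div_pow, ← add_div, div_eq_one_iff_eq (pow_ne_zero _ hm), ← h, pow_succ, pow_succ,
    pow_card_add (z + b), pow_card_add z b, one_pow]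
  linear_combination -hb

/-- The coordinate `w` is a Möbius transform of `z`, and `u` differs from `x 0` by a factor in
`E(z)`. So `u` has degree `q + 1` over `E(w) = E(z)`, the degree of the Fermat equation. -/
theorem IsGSSeq.exists_fermat_algEquiv {x : ℕ → Ω} (hx : IsGSSeq k 1 x)
    (ht : Transcendental E (x 0)) {β : E} (hβ : β ^ q + β = -1) :
    Nonempty (PlaneCurveField (fermatPoly q E) ≃ₐ[E] towerField E x 1) := by
  have hrel := (opU_eq_iff (hx.ne_zero zero_le_one)).1 (hx.2 0 zero_lt_one)
  obtain ⟨hz, hdegz⟩ := hx.minpoly_zero_eq ht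
  have hx0 := hx.ne_zero zero_le_one
  rw [zero_add] at hrel
  set z := x 0 * x 1 with hz_def
  let b := algebraMap E Ω β
  have hb : b ^ q + b = -1 := by simpa using congrArg (algebraMap E Ω) hβ
  have hm : z + b + 1 ≠ 0 := by
    intro h
    refine hz ?_
    have : z = algebraMap E Ω (-β - 1) := by
      simp only [map_sub, map_neg, map_one]
      linear_combination h
    rw [this]
    exact isAlgebraic_algebraMap _
  set u := x 0 / (z + b + 1) with hu
  set w := (z + b) / (z + b + 1) with hw
  have hbF (F : IntermediateField E Ω) : b ∈ F := F.algebraMap_mem β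
  have h1w : 1 - w = (z + b + 1)⁻¹ := by
    rw [hw]
    field_simp
    ring
  have hzw : z = w / (1 - w) - b := by
    rw [h1w, hw]
    field_simp
    ring
  have hxu : x 0 = u * (z + b + 1) := by rw [hu, div_mul_cancel₀ _ hm]
  have hEzw : E⟮w⟯ = E⟮z⟯ := by
    apply le_antisymm <;> rw [adjoin_simple_le_iff]
    · have h := mem_adjoin_simple_self E z
      exact div_mem (add_mem h (hbF _)) (add_mem (add_mem h (hbF _)) (one_mem _))
    · have h := mem_adjoin_simple_self E w
      rw [hzw]
      exact sub_mem (div_mem h (sub_mem (one_mem _) h)) (hbF _)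
  have htw : Transcendental E w := by
    intro h
    refine hz ?_
    have h1 : Algebra.IsAlgebraic E E⟮w⟯ := isAlgebraic_adjoin_simple h.isIntegral
    have h2 : z ∈ E⟮w⟯ := hEzw ▸ mem_adjoin_simple_self E z
    exact (h1.isAlgebraic ⟨z, h2⟩).algebraMap (A := Ω)
  let P : E[X][X] := X ^ (q + 1) - C (1 - X ^ (q + 1))
  have hP : bivariateToMv E 1 0 P = fermatPoly q E := by
    simp [P, fermatPoly]
    ring
  have hPm : P.Monic := monic_X_pow_sub_C _ (by lia)
  let c : Fin 2 → Ω := ![u, w]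
  have hdeg : (minpoly E⟮w⟯ u).degree = P.degree := by
    have hint : IsIntegral E⟮z⟯ (x 0) := by
      by_contra h
      rw [minpoly.eq_zero h, natDegree_zero] at hdegz
      lia
    have hmem : z + b + 1 ∈ E⟮z⟯ :=
      add_mem (add_mem (mem_adjoin_simple_self E z) (hbF _)) (one_mem _)
    have h1 := minpoly_natDegree_div hmem hm hint
    rw [hdegz, ← hu] at h1
    rw [hEzw, degree_eq_natDegree hPm.ne_zero, natDegree_X_pow_sub_C, degree_eq_natDegree, h1]
    intro h
    rw [h, natDegree_zero] at h1
    lia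
  have hker := ker_aeval_eq_span (c := c) (i := 1) (j := 0) (by decide) htw hPm hdeg (by
      rw [hP]
      have h1 := sub_eq_zero.2 (div_pow_add_div_pow_eq_one hrel hb hm)
      simpa [fermatPoly, c] using h1)
  rw [hP] at hker
  have hc : adjoin E (Set.range c) = towerField E x 1 := by
    rw [towerField_one hx0, ← hz_def]
    have hc' : Set.range c = {u, w} := by simp [c, Set.pair_comm]
    rw [hc']
    apply le_antisymm <;> rw [adjoin_le_iff]
    · have h0 : x 0 ∈ adjoin E {x 0, z} := subset_adjoin E _ (by simp)
      have h1 : z ∈ adjoin E {x 0, z} := subset_adjoin E _ (by simp)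
      have h2 := add_mem (add_mem h1 (hbF _)) (one_mem _)
      rintro _ (rfl | rfl)
      · exact div_mem h0 h2
      · exact div_mem (add_mem h1 (hbF _)) h2
    · have h0 : u ∈ adjoin E {u, w} := subset_adjoin E _ (by simp)
      have h1 : w ∈ adjoin E {u, w} := subset_adjoin E _ (by simp)
      have h2 : z ∈ adjoin E {u, w} := by
        rw [hzw]
        exact sub_mem (div_mem h1 (sub_mem (one_mem _) h1)) (hbF _)
      have h3 : x 0 ∈ adjoin E {u, w} := by
        rw [hxu]
        exact mul_mem h0 (add_mem (add_mem h2 (hbF _)) (one_mem _))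
      rintro y hy
      obtain rfl | rfl := hy
      · exact h3
      · exact h2
  exact ⟨(exists_planeCurveField_algEquiv hker hc).choose⟩

end HermitianCurve

/-! ### The modular tower -/

section ModularTower

variable {k : Type u} [Field k] [Fintype k] {E : Type v} [Field E] {Ω : Type w} [Field Ω]
  [Algebra k E] [Algebra k Ω] [Algebra (RatFunc E) Ω] [IsScalarTower k (RatFunc E) Ω]

local notation "q" => Fintype.card k

theorem exists_isLevelStructure_seq [IsSepClosed Ω] :
    ∃ (x₁ : Ω) (G : ℕ → Set Ω), ∀ n,
      (DrinfeldModule.normalized (RatFunc.X : RatFunc E)).IsLevelStructure k (n + 1) x₁ (G n) ∧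
      (DrinfeldModule.normalized (RatFunc.X : RatFunc E)).opT k Ω '' G (n + 1) = G n := by
  obtain ⟨x₁, h0, hg⟩ := exists_eq_gCoeff (k := k) (algebraMap (RatFunc E) Ω RatFunc.X)
  obtain ⟨x, rfl, hx⟩ := exists_isGSSeq (k := k) h0
  refine ⟨x 0, seqZeros k x, fun n ↦ ⟨(hx n).isLevelStructure ?_, ?_⟩⟩
  · rw [opT_normalized, hg]
  · rw [opT_normalized, hg, (hx (n + 1)).image_opN]

/-- A compatible sequence of level structures comes from one sequence of coordinates. -/
theorem exists_seq_of_isLevelStructure [IsSepClosed Ω] {x₁ : Ω} {G : ℕ → Set Ω}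
    (h : ∀ n,
      (DrinfeldModule.normalized (RatFunc.X : RatFunc E)).IsLevelStructure k (n + 1) x₁ (G n) ∧
      (DrinfeldModule.normalized (RatFunc.X : RatFunc E)).opT k Ω '' G (n + 1) = G n) :
    algebraMap (RatFunc E) Ω RatFunc.X = gCoeff k x₁ ∧
    ∃ x : ℕ → Ω, x 0 = x₁ ∧ ∀ n, IsGSSeq k n x ∧ G n = seqZeros k x n := by
  have hg := ((h 0).1.exists_isGSSeq (opT_normalized _)).1
  refine ⟨hg, ?_⟩
  choose s hs hs0 hG using fun n ↦ ((h n).1.exists_isGSSeq (opT_normalized _)).2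
  -- Compatibility under `φ_T` and uniqueness of coordinates make successive sequences agree, so the
  -- diagonal serves all levels.
  have hstep (n i : ℕ) (hi : i ≤ n) : s (n + 1) i = s n i := by
    refine ((hs (n + 1)).mono n.le_succ).eq_of_seqZeros_eq (hs n) (by rw [hs0, hs0]) ?_ hi
    rw [← (hs (n + 1)).image_opN, ← hG, ← hG, hs0, ← hg, ← opT_normalized, (h n).2]
  have hdiag (n i : ℕ) (hi : i ≤ n) : s n i = s i i := by
    induction n, hi using Nat.le_induction with
    | base => rfl
    | succ n hi ih => rw [hstep n i hi, ih]
  refine ⟨fun n ↦ s n n, hs0 0, fun n ↦ ⟨(hs n).congr (hdiag n), ?_⟩⟩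
  rw [hG]
  exact seqZeros_congr (hdiag n)

variable [Algebra E Ω] [IsScalarTower E (RatFunc E) Ω]

/-- The level structures on the generic normalized module are conjugate. -/
theorem exists_algEquiv_of_isLevelStructure [Normal (RatFunc E) Ω] {n : ℕ} {x₁ x₁' : Ω}
    {G G' : Set Ω}
    (h : (DrinfeldModule.normalized (RatFunc.X : RatFunc E)).IsLevelStructure k (n + 1) x₁ G)
    (h' : (DrinfeldModule.normalized (RatFunc.X : RatFunc E)).IsLevelStructure k (n + 1) x₁' G') :
    ∃ σ : Ω ≃ₐ[RatFunc E] Ω, σ x₁ = x₁' ∧ σ '' G = G' := by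
  obtain ⟨hg, x, hx, rfl, rfl⟩ := h.exists_isGSSeq (opT_normalized _)
  obtain ⟨hg', x', hx', rfl, rfl⟩ := h'.exists_isGSSeq (opT_normalized _)
  obtain ⟨σ, hσ⟩ := hx.exists_algEquiv hx' hg hg' le_rfl
  exact ⟨σ, hσ 0 n.zero_le, by rw [image_seqZeros]; exact seqZeros_congr hσ⟩

variable [IsSepClosed Ω]

theorem exists_gsCurve_of_isLevelStructure [IsGalois (RatFunc E) Ω] {n : ℕ} {x₁ : Ω} {G : Set Ω}
    (h : (DrinfeldModule.normalized (RatFunc.X : RatFunc E)).IsLevelStructure k (n + 1) x₁ G) :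
    ∃ x ∈ gsCurve q Ω n, x 0 = x₁ ∧ G = zerosP k x ∧
      algebraMap (RatFunc E) Ω RatFunc.X = (x₁ ^ q)⁻¹ * (x₁ ^ (q ^ 2) - x₁) ∧
      (levelField (RatFunc E) x₁ G).restrictScalars E = IntermediateField.adjoin E (Set.range x) ∧
      Transcendental E (x 0) ∧
      ∀ j : Fin n,
        (minpoly (IntermediateField.adjoin E (x '' Set.Iic j.castSucc))
          (x j.castSucc * x j.succ)).map (algebraMap _ Ω) =
        X ^ q + X - C (x j.castSucc ^ (q + 1)) := by
  obtain ⟨hg, s, hs, rfl, rfl⟩ := h.exists_isGSSeq (opT_normalized _)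
  have ht : Transcendental E (s 0) := transcendental_of_gCoeff_eq hg
  have himage (j : Fin (n + 1)) :
      (fun i : Fin (n + 1) ↦ s i) '' Set.Iic j = s '' Set.Iic (j : ℕ) := by
    ext y
    constructor
    · rintro ⟨i, hi, rfl⟩
      exact ⟨i, hi, rfl⟩
    · rintro ⟨i, hi, rfl⟩
      exact ⟨⟨i, lt_of_le_of_lt hi j.2⟩, hi, rfl⟩
  refine ⟨fun i ↦ s i, mem_gsCurve_iff.2 hs, rfl, rfl, hg, ?_, ht, fun j ↦ ?_⟩
  · have hlast : Set.Iic (Fin.last n) = Set.univ := Set.Iic_top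
    rw [hs.levelField_eq hg, ← Set.image_univ, ← hlast, himage]
    rfl
  · rw [himage]
    exact hs.map_minpoly_eq ht j.2

theorem exists_isGarciaStichtenothTower [IsGalois (RatFunc E) Ω] {x₁ : Ω} {G : ℕ → Set Ω}
    (h : ∀ n,
      (DrinfeldModule.normalized (RatFunc.X : RatFunc E)).IsLevelStructure k (n + 1) x₁ (G n) ∧
      (DrinfeldModule.normalized (RatFunc.X : RatFunc E)).opT k Ω '' G (n + 1) = G n) :
    ∃ x z : ℕ → Ω, x 0 = x₁ ∧
      (∀ n, G n = zerosP k (fun i : Fin (n + 1) ↦ x i)) ∧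
      IsGarciaStichtenothTower q E
        (fun n ↦ (levelField (RatFunc E) x₁ (G n)).restrictScalars E) x z := by
  obtain ⟨hg, x, rfl, hx⟩ := exists_seq_of_isLevelStructure h
  have ht : Transcendental E (x 0) := transcendental_of_gCoeff_eq hg
  refine ⟨x, fun n ↦ x n * x (n + 1), rfl, fun n ↦ (hx n).2, ?_⟩
  have hF : (fun n ↦ (levelField (RatFunc E) (x 0) (G n)).restrictScalars E) = towerField E x := by
    ext1 n
    rw [(hx n).2, (hx n).1.levelField_eq hg]
  have hne (n : ℕ) : x n ≠ 0 := (hx n).1.ne_zero le_rfl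
  rw [hF]
  exact ⟨ht, towerField_zero E x, fun n ↦ towerField_succ (hne n),
    fun n ↦ (hx (n + 1)).1.map_minpoly_eq ht n.lt_succ_self,
    fun n ↦ by rw [mul_div_cancel_left₀ _ (hne n)]⟩

theorem exists_planeCurveField_algEquiv_levelField [IsGalois (RatFunc E) Ω] {x₁ : Ω} {G : Set Ω}
    (h : (DrinfeldModule.normalized (RatFunc.X : RatFunc E)).IsLevelStructure k 2 x₁ G) :
    (∃ e : PlaneCurveField (hermitianPoly q E) ≃ₐ[E]
        (levelField (RatFunc E) x₁ G).restrictScalars E,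
      (e (PlaneCurveField.ofPoly _ (MvPolynomial.X 0)) : Ω) = x₁ ∧
      G = zerosP k ![x₁, (e (PlaneCurveField.ofPoly _ (MvPolynomial.X 1)) : Ω) / x₁]) ∧
    (Module.finrank k E = 2 →
      Nonempty (PlaneCurveField (fermatPoly q E) ≃ₐ[E]
        (levelField (RatFunc E) x₁ G).restrictScalars E)) := by
  obtain ⟨hg, x, hx, rfl, rfl⟩ := h.exists_isGSSeq (n := 1) (opT_normalized _)
  have ht : Transcendental E (x 0) := transcendental_of_gCoeff_eq hg
  rw [hx.levelField_eq hg]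
  refine ⟨?_, fun hE ↦ ?_⟩
  · obtain ⟨e, he0, he1⟩ := hx.exists_hermitian_algEquiv ht
    refine ⟨e, he0, ?_⟩
    rw [he1, mul_div_cancel_left₀ _ (hx.ne_zero zero_le_one), ← zerosP_coe]
    congr 1
    ext i
    fin_cases i <;> rfl
  · obtain ⟨β, hβ⟩ := exists_pow_card_add_self_eq_neg_one (k := k) hE
    exact hx.exists_fermat_algEquiv ht hβ

end ModularTower

theorem mainTheorem1 (k : Type u) [Field k] [Fintype k] (q : ℕ) (hq : q = Fintype.card k) :
    -- moduli interpretation over every field `L ⊇ k`, level `T ^ (n + 1)`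
    (∀ (L : Type v) (Ω : Type w) [Field L] [Field Ω] [Algebra k L] [Algebra k Ω] [Algebra L Ω]
      [IsScalarTower k L Ω] [IsSepClosed Ω] [Normal L Ω] (n : ℕ),
      (∀ x ∈ gsCurve q L n,
        (tModule q (x 0)).IsModuliPoint k (n + 1) (x 0) (zerosP k (algebraMap L Ω ∘ x))) ∧
      (∀ (φ : DrinfeldModule L) (x₁ : L) (G : Set Ω), φ.IsModuliPoint k (n + 1) x₁ G →
        ∃! x : Fin (n + 1) → L, x ∈ gsCurve q L n ∧
          φ = tModule q (x 0) ∧ x₁ = x 0 ∧ G = zerosP k (algebraMap L Ω ∘ x)) ∧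
      -- the generators of the torsion subgroup
      (∀ x ∈ gsCurve q L n,
        {y : Ω | opPComp k n (Fin.init (algebraMap L Ω ∘ x)) y =
            algebraMap L Ω (x (Fin.last n))}.ncard = q ^ n ∧
        ∀ y : Ω, opPComp k n (Fin.init (algebraMap L Ω ∘ x)) y =
            algebraMap L Ω (x (Fin.last n)) →
          Set.range (fun a => (tModule q (x 0)).action k Ω a y) =
            zerosP k (algebraMap L Ω ∘ x)) ∧
      -- passing from `G` to `T G` is forgetting the last coordinate
      (∀ x ∈ gsCurve q L (n + 1),
        (tModule q (x 0)).opT k Ω '' zerosP k (algebraMap L Ω ∘ x) =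
          zerosP k (Fin.init (algebraMap L Ω ∘ x)))) ∧
    -- function fields, over every constant field `E ⊇ k`; the base is the `g`-line,
    -- and `Ω` is a separable closure of `E(g)`
    (∀ (E : Type v) (Ω : Type w) [Field E] [Field Ω] [Algebra k E] [Algebra k Ω] [Algebra E Ω]
      [Algebra (RatFunc E) Ω] [IsScalarTower k (RatFunc E) Ω] [IsScalarTower E (RatFunc E) Ω]
      [IsSepClosure (RatFunc E) Ω] (φ : DrinfeldModule (RatFunc E)),
      φ = DrinfeldModule.normalized RatFunc.X →
      -- irreducibility of the curve: the level structures form one Galois orbit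
      (∀ n : ℕ,
        (∃ (x₁ : Ω) (G : Set Ω), φ.IsLevelStructure k (n + 1) x₁ G) ∧
        (∀ (x₁ x₁' : Ω) (G G' : Set Ω), φ.IsLevelStructure k (n + 1) x₁ G →
          φ.IsLevelStructure k (n + 1) x₁' G' →
          ∃ σ : Ω ≃ₐ[RatFunc E] Ω, σ x₁ = x₁' ∧ σ '' G = G') ∧
        -- the function field and its generators and relations
        (∀ (x₁ : Ω) (G : Set Ω), φ.IsLevelStructure k (n + 1) x₁ G →
          ∃ x ∈ gsCurve q Ω n, x 0 = x₁ ∧ G = zerosP k x ∧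
            algebraMap (RatFunc E) Ω RatFunc.X = (x₁ ^ q)⁻¹ * (x₁ ^ (q ^ 2) - x₁) ∧
            (levelField (RatFunc E) x₁ G).restrictScalars E =
              IntermediateField.adjoin E (Set.range x) ∧
            Transcendental E (x 0) ∧
            ∀ j : Fin n,
              (minpoly (IntermediateField.adjoin E (x '' Set.Iic j.castSucc))
                (x j.castSucc * x j.succ)).map (algebraMap _ Ω) =
              X ^ q + X - C (x j.castSucc ^ (q + 1)))) ∧
      -- the modular tower is the Garcia–Stichtenoth tower
      (∃ (x₁ : Ω) (G : ℕ → Set Ω), ∀ n, φ.IsLevelStructure k (n + 1) x₁ (G n) ∧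
        φ.opT k Ω '' G (n + 1) = G n) ∧
      (∀ (x₁ : Ω) (G : ℕ → Set Ω),
        (∀ n, φ.IsLevelStructure k (n + 1) x₁ (G n) ∧ φ.opT k Ω '' G (n + 1) = G n) →
        ∃ x z : ℕ → Ω, x 0 = x₁ ∧
          (∀ n, G n = zerosP k (fun i : Fin (n + 1) => x i)) ∧
          IsGarciaStichtenothTower q E
            (fun n => (levelField (RatFunc E) x₁ (G n)).restrictScalars E) x z) ∧
      -- level `T ^ 2`: the Hermitian curve, isomorphic to the Fermat curve over the quadratic
      -- extension of `k`
      (∀ (x₁ : Ω) (G : Set Ω), φ.IsLevelStructure k 2 x₁ G →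
        (∃ e : PlaneCurveField (hermitianPoly q E) ≃ₐ[E]
            (levelField (RatFunc E) x₁ G).restrictScalars E,
          (e (PlaneCurveField.ofPoly _ (MvPolynomial.X 0)) : Ω) = x₁ ∧
          G = zerosP k
            ![x₁, (e (PlaneCurveField.ofPoly _ (MvPolynomial.X 1)) : Ω) / x₁]) ∧
        (Module.finrank k E = 2 →
          Nonempty (PlaneCurveField (fermatPoly q E) ≃ₐ[E]
            (levelField (RatFunc E) x₁ G).restrictScalars E)))) := by
  subst hq
  refine ⟨?_, ?_⟩
  · intro L Ω _ _ _ _ _ _ _ _ n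
    exact ⟨fun x hx ↦ isModuliPoint_of_mem_gsCurve hx,
      fun φ x₁ G h ↦ existsUnique_of_isModuliPoint h,
      fun x hx ↦ ⟨ncard_generators hx, fun y hy ↦ range_action_eq hx hy⟩,
      fun x hx ↦ image_opT_zerosP hx⟩
  · rintro E Ω _ _ _ _ _ _ _ _ _ φ rfl
    have : IsSepClosed Ω := IsSepClosure.sep_closed (RatFunc E)
    refine ⟨fun n ↦ ⟨?_, fun x₁ x₁' G G' h h' ↦ exists_algEquiv_of_isLevelStructure h h',
      fun x₁ G h ↦ exists_gsCurve_of_isLevelStructure h⟩, exists_isLevelStructure_seq,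
      fun x₁ G h ↦ exists_isGarciaStichtenothTower h,
      fun x₁ G h ↦ exists_planeCurveField_algEquiv_levelField h⟩
    obtain ⟨x₁, G, h⟩ := exists_isLevelStructure_seq (k := k) (E := E) (Ω := Ω)
    exact ⟨x₁, G n, (h n).1⟩
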